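/- Let $\mathcal{C}$ be a (locally small) category and let $F = [P,-] : \mathcal{C} \to \mathbf{Set}$ be the functor prorepresented by a pro-object $P$ of $\mathcal{C}$, that is, $F = \operatorname{colim}_i \mathcal{C}(P_i,-)$ for a diagram $(P_i)$ in $\mathcal{C}$ indexed by a small cofiltered category. An arrow $f : X \to Y$ is a strict epimorphism if every $g : X \to Z$ such that $gs = gt$ whenever $fs = ft$ (for all $s, t : W \to X$) factors uniquely as $g = hf$. Assume: (i) every arrow of $\mathcal{C}$ is a strict epimorphism; (ii) $FX \neq \emptyset$ for every $X \in \mathcal{C}$; (iii) $F$ preserves strict epimorphisms. Let $D_{\Delta F}$ be the preordered class of all $(X, (x_0, x_1))$ with $x_0, x_1 \in FX$, where $(X,(x_0,x_1)) \leq (Y,(y_0,y_1))$ if there is $f : X \to Y$ with $F(f)(x_i) = y_i$, $i = 0, 1$. Let $G = \mathrm{lAut}(F)$ be the locale of $2$-valued sheaves on the free inf-lattice on $D_{\Delta F}$, with generators $[(X,\langle x|y\rangle)]$, for the topology generated by: the empty family covers $[(X,\langle z|x\rangle)] \wedge [(X,\langle z|y\rangle)]$ and $[(X,\langle x|z\rangle)]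 \wedge [(X,\langle y|z\rangle)]$ for $x \neq y$, $z$ in $FX$; the families $([(X,\langle z|x\rangle)])_{x \in FX}$ and $([(X,\langle x|z\rangle)])_{x \in FX}$ cover $1$ for $z \in FX$. It is a localic group with multiplication given by $m^*[(X,\langle x|y\rangle)] = \bigvee_z [(X,\langle x|z\rangle)] \otimes [(X,\langle z|y\rangle)]$. For a set $S$, the localic group $\mathrm{lAut}(S)$, with generators $[\langle s|t\rangle]$, is the case of the functor with value $S$ on the category with one arrow. A $G$-set is a set $S$ with a morphism of localic groups $\mu : G \to \mathrm{lAut}(S)$; a morphism of $G$-sets is a function $h : S \to T$ with $\mu^*[\langle s|s'\rangle] \leq \mu^*[\langle h(s)|h(s')\rangle]$ for all $s, s' \in S$; this defines the category $\mathcal{B}G$. A $G$-set is transitive if $\mu^*[\langle s|s'\rangle] \neq 0$ for all $s, s' \in S$. The functor $\mu F : \mathcal{C} \to \mathcal{B}G$ sends $X$ to the set $FX$ with the action $[\langle x|y\rangle] \mapsto [(X,\langle x|y\rangle)]$. Then $\mu F$ takes values in the nonempty transitive $G$-sets. If moreover $\mathcal{C}$ is small, then $G$ is small, and: (a) if $\mathcal{C}$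 is not equivalent to the category with a single arrow, then $\mu F$ induces an equivalence of categories $\mathcal{C}^{\sim} \simeq \mathcal{B}G$, where $\mathcal{C}^{\sim}$ is the topos of sheaves on $\mathcal{C}$ for the canonical topology; (b) in all cases, the atomic topology on $\mathcal{C}$ (the covering sieves are the nonempty ones) is defined, that is, any two arrows of $\mathcal{C}$ with the same codomain complete to a commutative square, and $\mu F$ induces an equivalence between the topos of sheaves on $\mathcal{C}$ for the atomic topology and $\mathcal{B}G$. Here "$\mu F$ induces an equivalence" means that there is an equivalence whose inverse $\mathcal{B}G \to \mathcal{C}^{\sim}$ is $S \mapsto \mathcal{B}G(\mu F(-), S)$, and which sends the representable sheaf $\mathcal{C}(-,X)$ to $\mu F(X)$, naturally in $X$. -/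

import Mathlib

namespace LocalicGalois

open CategoryTheory Limits Opposite

universe w w' v u v₁

/-! ### Locales of `2`-valued sheaves on an inf-lattice with basic covers -/

section Site

variable {D : Type w} [SemilatticeInf D]

/-- The locale `D^~` of `2`-valued sheaves on an inf-lattice `D` for the topology generated by
the basic covers `cov` (`cov u S` says that the family of all `s ∈ S` covers `u`), as a
sublocale of the locale `D^∧` of downward closed subsets: those `T` which satisfy the sheaf condition for
every pullback `(s ⊓ v → u ⊓ v)` of a basic cover. -/
def sheaves (cov : D → Set D → Prop) : Sublocale (LowerSet D) where
  carrier := {T | ∀ u S, cov u S → ∀ v, (∀ s ∈ S, s ⊓ v ∈ T) → u ⊓ v ∈ T}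
  sInf_mem' A hA u S hS v h := by
    simp only [LowerSet.mem_sInf_iff] at h ⊢
    exact fun T hT => hA hT u S hS v fun s hs => h s hs T hT
  himp_mem' A T hT u S hS v h := by
    have key : ∀ w, w ∈ A ⇨ T ↔ ∀ w' ≤ w, w' ∈ A → w' ∈ T := by
      intro w
      rw [← LowerSet.Iic_le, le_himp_iff]
      exact ⟨fun h w' hw hA => h ⟨hw, hA⟩, fun h w' hw => h w' hw.1 hw.2⟩
    rw [key]
    intro w hw hA
    have h1 : u ⊓ w = w := inf_eq_right.2 (hw.trans inf_le_left)
    rw [← h1]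
    refine hT u S hS w fun s hs => (key _).1 (h s hs) _ ?_ (A.lower inf_le_right hA)
    exact inf_le_inf_left _ (hw.trans inf_le_right)

variable {cov : D → Set D → Prop}

/-- The associated sheaf `#u` of (the presheaf represented by) an object `u` of the site. -/
def sharp (cov : D → Set D → Prop) (u : D) : sheaves cov :=
  (sheaves cov).restrict (LowerSet.Iic u)

lemma sharp_le {u : D} {T : sheaves cov} : sharp cov u ≤ T ↔ u ∈ T.1 := by
  rw [← LowerSet.Iic_le]
  exact (sheaves cov).giRestrict.gc _ _

lemma sharp_inf (u v : D) : sharp cov (u ⊓ v) = sharp cov u ⊓ sharp cov v := by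
  rw [sharp, sharp, sharp, ← map_inf, LowerSet.Iic_inf]

lemma sharp_top [OrderTop D] : sharp cov ⊤ = ⊤ := by
  rw [sharp, LowerSet.Iic_top, map_top]

lemma sharp_cov {u : D} {S : Set D} (h : cov u S) : sharp cov u ≤ ⨆ s ∈ S, sharp cov s := by
  rw [sharp_le, ← inf_idem u]
  refine (⨆ s ∈ S, sharp cov s).2 u S h u fun s hs => LowerSet.lower _ inf_le_left ?_
  exact sharp_le.1 (le_iSup₂_of_le s hs le_rfl)

lemma eq_iSup_sharp (T : sheaves cov) : T = ⨆ u ∈ T.1, sharp cov u := by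
  refine le_antisymm (fun u hu => ?_) (iSup₂_le fun u hu => sharp_le.2 hu)
  exact sharp_le.1 (le_iSup₂_of_le (f := fun u (_ : u ∈ T.1) => sharp cov u) u hu le_rfl)

variable {H : Type v} [Order.Frame H]

lemma lift_gc (f : D → H) (hinf : ∀ a b, f (a ⊓ b) = f a ⊓ f b)
    (hcov : ∀ u S, cov u S → f u ≤ ⨆ s ∈ S, f s) (h : H) :
    ∃ R : sheaves cov, ∀ u, u ∈ R.1 ↔ f u ≤ h := by
  have mono : Monotone f := fun a b hab => by
    rw [← inf_eq_left.2 hab, hinf]; exact inf_le_right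
  refine ⟨⟨⟨{u | f u ≤ h}, fun a b hab hb => (mono hab).trans hb⟩, ?_⟩, fun u => Iff.rfl⟩
  intro u S hS v hv
  change f (u ⊓ v) ≤ h
  rw [hinf]
  refine (inf_le_inf_right _ (hcov u S hS)).trans ?_
  rw [iSup₂_inf_eq]
  refine iSup₂_le fun s hs => ?_
  rw [← hinf]
  exact hv s hs

/-- The morphism of locales out of `D^~` extending a point `f : D → H` of the site. -/
def liftSheaves [OrderTop D] (f : D → H) (hinf : ∀ a b, f (a ⊓ b) = f a ⊓ f b) (htop : f ⊤ = ⊤)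
    (hcov : ∀ u S, cov u S → f u ≤ ⨆ s ∈ S, f s) : FrameHom (sheaves cov) H where
  toFun T := ⨆ u ∈ T.1, f u
  map_inf' S T := by
    refine le_antisymm (le_inf ?_ ?_) ?_
    · exact iSup₂_le fun u hu => le_iSup₂_of_le u hu.1 le_rfl
    · exact iSup₂_le fun u hu => le_iSup₂_of_le u hu.2 le_rfl
    · rw [iSup₂_inf_eq]
      refine iSup₂_le fun a ha => ?_
      rw [inf_iSup₂_eq]
      refine iSup₂_le fun b hb => ?_
      rw [← hinf]
      exact le_iSup₂_of_le (f := fun u _ => f u) (a ⊓ b)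
        ⟨S.1.lower inf_le_left ha, T.1.lower inf_le_right hb⟩ le_rfl
  map_top' := top_unique (htop.ge.trans (le_iSup₂_of_le (f := fun u _ => f u) ⊤ trivial le_rfl))
  map_sSup' A := by
    refine le_antisymm ?_ ?_
    · obtain ⟨R, hR⟩ := lift_gc f hinf hcov (sSup ((fun T : sheaves cov => ⨆ u ∈ T.1, f u) '' A))
      have : sSup A ≤ R := sSup_le fun T hT u hu =>
        (hR u).2 ((le_iSup₂_of_le (f := fun u _ => f u) u hu le_rfl).trans
          (le_sSup ⟨T, hT, rfl⟩))
      exact iSup₂_le fun u hu => (hR u).1 (this hu)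
    · refine sSup_le ?_
      rintro _ ⟨T, hT, rfl⟩
      exact iSup₂_le fun u hu => le_iSup₂_of_le (f := fun u _ => f u) u (le_sSup hT hu) le_rfl

lemma liftSheaves_sharp [OrderTop D] (f : D → H) (hinf : ∀ a b, f (a ⊓ b) = f a ⊓ f b) (htop : f ⊤ = ⊤)
    (hcov : ∀ u S, cov u S → f u ≤ ⨆ s ∈ S, f s) (u : D) :
    liftSheaves f hinf htop hcov (sharp cov u) = f u := by
  refine le_antisymm ?_ (le_iSup₂_of_le (f := fun u _ => f u) u (sharp_le.1 le_rfl) le_rfl)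
  obtain ⟨R, hR⟩ := lift_gc (cov := cov) f hinf hcov (f u)
  have : sharp cov u ≤ R := sharp_le.2 ((hR u).2 le_rfl)
  exact iSup₂_le fun w hw => (hR w).1 (this hw)

lemma frameHom_ext_sharp {φ ψ : FrameHom (sheaves cov) H}
    (h : ∀ u, φ (sharp cov u) = ψ (sharp cov u)) : φ = ψ := by
  ext T
  rw [eq_iSup_sharp T]
  simp only [map_iSup, h]

end Site

/-! ### Products of locales -/

section Product

variable (A : Type w) (B : Type w) [Order.Frame A] [Order.Frame B]

/-- The basic covers on the inf-lattice `A × B` which present the coproduct of the frames. -/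
inductive TensorCov : A × B → Set (A × B) → Prop
  | left (S : Set A) (b : B) : TensorCov (sSup S, b) ((fun a => (a, b)) '' S)
  | right (a : A) (S : Set B) : TensorCov (a, sSup S) ((fun b => (a, b)) '' S)

/-- The underlying frame `A ⊗ B` of the product of two localic spaces; `sharp (a, b)` is
`a ⊗ b`. -/
abbrev Tensor : Type w := sheaves (TensorCov A B)

variable {A B}

def tensorInl : FrameHom A (Tensor A B) where
  toFun a := sharp _ (a, ⊤)
  map_inf' a b := by rw [← sharp_inf]; simp
  map_top' := sharp_top
  map_sSup' S := by
    refine le_antisymm ((sharp_cov (.left S ⊤)).trans ?_) (sSup_le ?_)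
    · refine iSup₂_le ?_
      rintro _ ⟨a, ha, rfl⟩
      exact le_sSup ⟨a, ha, rfl⟩
    · rintro _ ⟨a, ha, rfl⟩
      rw [sharp_le]
      exact LowerSet.lower _ (show (a, ⊤) ≤ (sSup S, (⊤ : B)) from ⟨le_sSup ha, le_rfl⟩)
        (sharp_le.1 le_rfl)

def tensorInr : FrameHom B (Tensor A B) where
  toFun b := sharp _ (⊤, b)
  map_inf' a b := by rw [← sharp_inf]; simp
  map_top' := sharp_top
  map_sSup' S := by
    refine le_antisymm ((sharp_cov (.right ⊤ S)).trans ?_) (sSup_le ?_)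
    · refine iSup₂_le ?_
      rintro _ ⟨a, ha, rfl⟩
      exact le_sSup ⟨a, ha, rfl⟩
    · rintro _ ⟨a, ha, rfl⟩
      rw [sharp_le]
      exact LowerSet.lower _ (show (⊤, a) ≤ ((⊤ : A), sSup S) from ⟨le_rfl, le_sSup ha⟩)
        (sharp_le.1 le_rfl)

lemma sharp_eq_inl_inf_inr (a : A) (b : B) :
    sharp (TensorCov A B) (a, b) = tensorInl a ⊓ tensorInr b := by
  change _ = sharp _ (a, ⊤) ⊓ sharp _ (⊤, b)
  rw [← sharp_inf]; simp

variable {H : Type w} [Order.Frame H]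

def tensorDesc (f : FrameHom A H) (g : FrameHom B H) : FrameHom (Tensor A B) H :=
  liftSheaves (fun p => f p.1 ⊓ g p.2)
    (fun p q => by simp only [Prod.fst_inf, Prod.snd_inf, map_inf]; exact inf_inf_inf_comm _ _ _ _)
    (by simp)
    (by
      rintro _ _ (⟨S, b⟩ | ⟨a, S⟩)
      · simp only [map_sSup, sSup_inf_eq, iSup_image]
        exact le_rfl
      · simp only [map_sSup, inf_sSup_eq, iSup_image]
        exact le_rfl)

lemma tensorDesc_inl (f : FrameHom A H) (g : FrameHom B H) (a : A) :
    tensorDesc f g (tensorInl a) = f a := by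
  refine (liftSheaves_sharp _ _ _ _ _).trans ?_
  simp

lemma tensorDesc_inr (f : FrameHom A H) (g : FrameHom B H) (b : B) :
    tensorDesc f g (tensorInr b) = g b := by
  refine (liftSheaves_sharp _ _ _ _ _).trans ?_
  simp

lemma tensor_hom_ext {φ ψ : FrameHom (Tensor A B) H}
    (h₁ : ∀ a, φ (tensorInl a) = ψ (tensorInl a))
    (h₂ : ∀ b, φ (tensorInr b) = ψ (tensorInr b)) : φ = ψ := by
  refine frameHom_ext_sharp fun p => ?_
  rw [← Prod.mk.eta (p := p), sharp_eq_inl_inf_inr, map_inf, map_inf, h₁, h₂]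

end Product

/-! ### The cartesian category of localic spaces -/

section LocaleCat

/-- The category of localic spaces: the formal dual of the category of locales (frames).
The locale corresponding to `G` is `G.unop`. -/
abbrev LocalicSpace := Frm.{w}ᵒᵖ

/-- The inverse image `f^*` of a continuous map `f` of localic spaces. -/
def invImage {G H : LocalicSpace.{w}} (f : G ⟶ H) : FrameHom H.unop G.unop :=
  Frm.Hom.hom (f.unop)

/-- The continuous map of localic spaces with a given inverse image. -/
def ofInvImage {G H : LocalicSpace.{w}} (φ : FrameHom H.unop G.unop) : G ⟶ H :=
  (Frm.ofHom φ).op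

@[simp] lemma invImage_ofInvImage {G H : LocalicSpace.{w}} (φ : FrameHom H.unop G.unop) :
    invImage (ofInvImage φ) = φ := rfl

@[simp] lemma ofInvImage_invImage {G H : LocalicSpace.{w}} (f : G ⟶ H) :
    ofInvImage (invImage f) = f := rfl

@[simp] lemma invImage_comp_apply {G H K : LocalicSpace.{w}} (f : G ⟶ H) (g : H ⟶ K) (k : K.unop) :
    invImage (f ≫ g) k = invImage f (invImage g k) := rfl

@[simp] lemma invImage_id_apply {G : LocalicSpace.{w}} (k : G.unop) : invImage (𝟙 G) k = k := rfl

lemma locale_hom_ext {G H : LocalicSpace.{w}} {f g : G ⟶ H} (h : invImage f = invImage g) : f = g := by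
  rw [← ofInvImage_invImage f, h, ofInvImage_invImage]

/-- The one-point localic space. -/
def pointLocale : LocalicSpace.{w} := op (Frm.of (Set PUnit.{w + 1}))

def toPointInv (G : Type w) [Order.Frame G] : FrameHom (Set PUnit.{w + 1}) G where
  toFun S := ⨆ _ : PUnit.unit ∈ S, ⊤
  map_inf' S T := by
    by_cases h : PUnit.unit ∈ S <;> by_cases h' : PUnit.unit ∈ T <;> simp [h, h']
  map_top' := by simp
  map_sSup' A := by
    refine le_antisymm (iSup_le fun ⟨S, hS, h⟩ => ?_) (sSup_le ?_)
    · exact le_sSup_of_le ⟨S, hS, rfl⟩ (le_iSup_of_le h le_rfl)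
    · rintro _ ⟨S, hS, rfl⟩
      exact iSup_le fun h => le_iSup_of_le (ι := PUnit.unit ∈ sSup A) ⟨S, hS, h⟩ le_rfl

lemma eq_toPointInv {G : Type w} [Order.Frame G] (φ : FrameHom (Set PUnit.{w + 1}) G) :
    φ = toPointInv G := by
  ext S
  change φ S = ⨆ _ : PUnit.unit ∈ S, ⊤
  by_cases h : PUnit.unit ∈ S
  · rw [show S = ⊤ from Set.eq_univ_of_forall fun _ => h, map_top]; simp
  · rw [show S = ⊥ from Set.eq_empty_of_forall_notMem fun _ => h, map_bot]; simp

def isTerminalPoint : IsTerminal pointLocale.{w} :=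
  IsTerminal.ofUniqueHom (fun G => ofInvImage (toPointInv G.unop)) fun _ _ =>
    locale_hom_ext (eq_toPointInv _)

/-- The product of two localic spaces. -/
def prodLocale (G H : LocalicSpace.{w}) : LocalicSpace.{w} := op (Frm.of (Tensor G.unop H.unop))

def prodFst (G H : LocalicSpace.{w}) : prodLocale G H ⟶ G := ofInvImage (tensorInl (A := G.unop) (B := H.unop))

def prodSnd (G H : LocalicSpace.{w}) : prodLocale G H ⟶ H := ofInvImage (tensorInr (A := G.unop) (B := H.unop))

def prodLift {G H K : LocalicSpace.{w}} (f : K ⟶ G) (g : K ⟶ H) : K ⟶ prodLocale G H :=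
  ofInvImage (tensorDesc (invImage f) (invImage g))

def isLimitProd (G H : LocalicSpace.{w}) : IsLimit (BinaryFan.mk (prodFst G H) (prodSnd G H)) :=
  BinaryFan.isLimitMk (fun s => prodLift s.fst s.snd)
    (fun _ => locale_hom_ext (FrameHom.ext fun _ => tensorDesc_inl _ _ _))
    (fun _ => locale_hom_ext (FrameHom.ext fun _ => tensorDesc_inr _ _ _))
    (fun _ _ h₁ h₂ => locale_hom_ext (tensor_hom_ext
      (fun a => (congrArg (fun f => invImage f a) h₁).trans (tensorDesc_inl _ _ _).symm)
      (fun b => (congrArg (fun f => invImage f b) h₂).trans (tensorDesc_inr _ _ _).symm)))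

instance : CartesianMonoidalCategory LocalicSpace.{w} :=
  CartesianMonoidalCategory.ofChosenFiniteProducts ⟨asEmptyCone pointLocale, isTerminalPoint⟩
    fun G H => ⟨BinaryFan.mk (prodFst G H) (prodSnd G H), isLimitProd G H⟩

end LocaleCat

/-! ### The free inf-lattice on a poset -/

section FreeInf

variable (P : Type w) [Preorder P]

/-- The free inf-lattice `𝒟(P)` on a poset `P`: the finitely generated upward closed subsets of
`P`, ordered by reverse inclusion (this is the order of `UpperSet P`). -/
def FreeInf : Type w := {U : UpperSet P // ∃ s : Set P, s.Finite ∧ upperClosure s = U}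

namespace FreeInf

instance : SemilatticeInf (FreeInf P) :=
  Subtype.semilatticeInf fun {_ _} ⟨s, hs, h⟩ ⟨t, ht, h'⟩ =>
    ⟨s ∪ t, hs.union ht, by rw [upperClosure_union, h, h']⟩

instance : OrderTop (FreeInf P) :=
  Subtype.orderTop ⟨∅, Set.finite_empty, upperClosure_empty⟩

variable {P}

/-- The generator `[p]` of `𝒟(P)`. -/
def gen (p : P) : FreeInf P :=
  ⟨upperClosure {p}, {p}, Set.finite_singleton p, rfl⟩

lemma gen_mono {p q : P} (h : p ≤ q) : gen p ≤ gen q := by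
  change upperClosure {p} ≤ upperClosure {q}
  simpa using h

lemma induction {motive : FreeInf P → Prop} (top : motive ⊤)
    (inf : ∀ p U, motive U → motive (gen p ⊓ U)) (U : FreeInf P) : motive U := by
  obtain ⟨U, s, hs, rfl⟩ := U
  induction s, hs using Set.Finite.induction_on with
  | empty =>
    have e : (⟨upperClosure ∅, ∅, Set.finite_empty, rfl⟩ : FreeInf P) = (⊤ : FreeInf P) :=
      Subtype.ext upperClosure_empty
    exact e ▸ top
  | @insert p t _ ht ih =>
    have e : (⟨upperClosure (insert p t), insert p t, ht.insert p, rfl⟩ : FreeInf P) =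
        gen p ⊓ ⟨upperClosure t, t, ht, rfl⟩ := by
      apply Subtype.ext
      change upperClosure (insert p t) = upperClosure {p} ⊓ upperClosure t
      rw [Set.insert_eq, upperClosure_union]
    exact e ▸ inf p _ ih

/-- The inf-preserving extension of an order preserving map `P → H`. -/
def ext {H : Type v} [CompleteLattice H] (φ : P → H) (U : FreeInf P) : H := ⨅ p ∈ U.1, φ p

lemma ext_inf {H : Type v} [CompleteLattice H] (φ : P → H) (U V : FreeInf P) :
    ext φ (U ⊓ V) = ext φ U ⊓ ext φ V := by
  change (⨅ p ∈ U.1 ⊓ V.1, φ p) = _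
  simp only [UpperSet.mem_inf_iff, iInf_or, iInf_inf_eq]
  rfl

lemma ext_top {H : Type v} [CompleteLattice H] (φ : P → H) : ext φ ⊤ = ⊤ := by
  change (⨅ p ∈ (⊤ : UpperSet P), φ p) = ⊤
  simp

lemma ext_gen {H : Type v} [CompleteLattice H] {φ : P → H} (hφ : Monotone φ) (p : P) :
    ext φ (gen p) = φ p := by
  change (⨅ q ∈ upperClosure {p}, φ q) = φ p
  refine le_antisymm (iInf₂_le p (by simp)) (le_iInf₂ fun q hq => hφ ?_)
  simpa using hq

end FreeInf

end FreeInf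

/-! ### The localic group of automorphisms of a set-valued functor -/

section LAut

variable {C : Type u} [Category.{v₁} C] (F : C ⥤ Type v)

/-- The poset `D_{ΔF}`: its elements `⟨X, (x₀, x₁)⟩`, with `x₀, x₁ ∈ FX`, are ordered by
`⟨X, (x₀, x₁)⟩ ≤ ⟨Y, (y₀, y₁)⟩` if and only if there is `f : X ⟶ Y` with `F(f)(x₀) = y₀` and
`F(f)(x₁) = y₁`. -/
def RelPoset : Type (max u v) := Σ X : C, F.obj X × F.obj X

instance : Preorder (RelPoset F) where
  le p q := ∃ f : p.1 ⟶ q.1, F.map f p.2.1 = q.2.1 ∧ F.map f p.2.2 = q.2.2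
  le_refl p := ⟨𝟙 _, by simp, by simp⟩
  le_trans p q r := by
    rintro ⟨f, h₁, h₂⟩ ⟨g, h₃, h₄⟩
    exact ⟨f ≫ g, by simp [h₁, h₃], by simp [h₂, h₄]⟩

variable {F} in
/-- The object `[(X, <x | y>)]` of the site `𝒟(D_{ΔF})`. -/
def relGen (X : C) (x y : F.obj X) : FreeInf (RelPoset F) :=
  FreeInf.gen (⟨X, (x, y)⟩ : RelPoset F)

/-- The basic covers which force a natural relation on `F` to be, in turn, univalued, injective,
everywhere defined and surjective. -/
inductive AutCov : FreeInf (RelPoset F) → Set (FreeInf (RelPoset F)) → Prop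
  | univalued (X : C) (x y z : F.obj X) (h : x ≠ y) : AutCov (relGen X z x ⊓ relGen X z y) ∅
  | injective (X : C) (x y z : F.obj X) (h : x ≠ y) : AutCov (relGen X x z ⊓ relGen X y z) ∅
  | total (X : C) (z : F.obj X) : AutCov ⊤ (Set.range fun x => relGen X z x)
  | surjective (X : C) (z : F.obj X) : AutCov ⊤ (Set.range fun x => relGen X x z)

/-- The locale `lAut(F)` of automorphisms of `F`: the locale of sheaves on the site
`𝒟(D_{ΔF})`. -/
abbrev LAutFrame : Type (max u v) := sheaves (AutCov F)

/-- The localic space `lAut(F)`. -/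
def lAut : LocalicSpace.{max u v} := op (Frm.of (LAutFrame F))

variable {F} in
/-- The element `#[(X, <x | y>)]` of the locale `lAut(F)`. -/
def lAutGen (X : C) (x y : F.obj X) : LAutFrame F := sharp (AutCov F) (relGen X x y)

/-- An `H`-valued automorphism of `F`, for `H` a locale: an `H`-valued natural relation on `F`
which is univalued, injective, everywhere defined and surjective. -/
@[ext]
structure ValuedAut (H : Type w) [Order.Frame H] where
  val : ∀ X : C, F.obj X → F.obj X → H
  natural : ∀ {X Y : C} (f : X ⟶ Y) (x y : F.obj X),
    val X x y ≤ val Y (F.map f x) (F.map f y)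
  univalued : ∀ (X : C) (x y z : F.obj X), x ≠ y → val X z x ⊓ val X z y = ⊥
  injective : ∀ (X : C) (x y z : F.obj X), x ≠ y → val X x z ⊓ val X y z = ⊥
  total : ∀ (X : C) (z : F.obj X), ⨆ x, val X z x = ⊤
  surjective : ∀ (X : C) (z : F.obj X), ⨆ x, val X x z = ⊤

namespace ValuedAut

variable {F} {H : Type w} [Order.Frame H]

open Classical in
noncomputable instance : One (ValuedAut F H) where
  one :=
    { val := fun _ x y => if x = y then ⊤ else ⊥
      natural := fun f x y => by by_cases h : x = y <;> simp [h]
      univalued := fun X x y z h => by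
        by_cases h₁ : z = x
        · subst h₁; simp [h]
        · simp [h₁]
      injective := fun X x y z h => by
        by_cases h₁ : x = z
        · subst h₁; simp [h.symm]
        · simp [h₁]
      total := fun X z => top_unique (le_iSup_of_le z (by simp))
      surjective := fun X z => top_unique (le_iSup_of_le z (by simp)) }

instance : Inv (ValuedAut F H) where
  inv a :=
    { val := fun X x y => a.val X y x
      natural := fun f x y => a.natural f y x
      univalued := a.injective
      injective := a.univalued
      total := a.surjective
      surjective := a.total }

instance : Mul (ValuedAut F H) where
  mul a b :=
    { val := fun X x y => ⨆ z, a.val X x z ⊓ b.val X z y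
      natural := fun f x y => iSup_le fun z =>
        le_iSup_of_le (F.map f z) (inf_le_inf (a.natural f x z) (b.natural f z y))
      univalued := fun X x y z h => by
        rw [iSup_inf_iSup]
        refine bot_unique (iSup_le fun p => ?_)
        rw [inf_inf_inf_comm]
        by_cases hp : p.1 = p.2
        · rw [hp, b.univalued X x y _ h, inf_bot_eq]
        · rw [a.univalued X _ _ _ hp, bot_inf_eq]
      injective := fun X x y z h => by
        rw [iSup_inf_iSup]
        refine bot_unique (iSup_le fun p => ?_)
        rw [inf_inf_inf_comm]
        by_cases hp : p.1 = p.2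
        · rw [hp, a.injective X x y _ h, bot_inf_eq]
        · rw [b.injective X _ _ _ hp, inf_bot_eq]
      total := fun X z => by
        rw [iSup_comm]
        simp only [← inf_iSup_eq, b.total, inf_top_eq, a.total]
      surjective := fun X z => by
        rw [iSup_comm]
        simp only [← iSup_inf_eq, a.surjective, top_inf_eq, b.surjective] }

open Classical in
lemma one_val (X : C) (x y : F.obj X) :
    (1 : ValuedAut F H).val X x y = if x = y then ⊤ else ⊥ := rfl

lemma mul_val (a b : ValuedAut F H) (X : C) (x y : F.obj X) :
    (a * b).val X x y = ⨆ z, a.val X x z ⊓ b.val X z y := rfl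

lemma inv_val (a : ValuedAut F H) (X : C) (x y : F.obj X) :
    a⁻¹.val X x y = a.val X y x := rfl

/-- The `H`-valued automorphisms of `F` form a group under composition of relations. -/
noncomputable instance : Group (ValuedAut F H) :=
  Group.ofLeftAxioms
    (fun a b c => by
      ext X x y
      simp only [mul_val, iSup_inf_eq, inf_iSup_eq]
      rw [iSup_comm]
      simp only [inf_assoc])
    (fun a => by
      ext X x y
      rw [mul_val]
      refine le_antisymm (iSup_le fun z => ?_) (le_iSup_of_le x (by simp [one_val]))
      by_cases h : x = z
      · subst h; exact inf_le_right
      · simp [one_val, h])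
    (fun a => by
      ext X x y
      rw [mul_val, one_val]
      split_ifs with h
      · subst h
        simp only [inv_val, inf_idem, a.surjective]
      · refine bot_unique (iSup_le fun z => ?_)
        rw [inv_val, a.univalued X x y z h])

/-- The image of an `H`-valued automorphism under a morphism of locales. -/
def map {K : Type w'} [Order.Frame K] (φ : FrameHom H K) (a : ValuedAut F H) : ValuedAut F K where
  val X x y := φ (a.val X x y)
  natural f x y := OrderHomClass.mono φ (a.natural f x y)
  univalued X x y z h := by rw [← map_inf, a.univalued X x y z h, map_bot]
  injective X x y z h := by rw [← map_inf, a.injective X x y z h, map_bot]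
  total X z := by rw [← map_iSup, a.total, map_top]
  surjective X z := by rw [← map_iSup, a.surjective, map_top]

lemma map_mul {K : Type w'} [Order.Frame K] (φ : FrameHom H K) (a b : ValuedAut F H) :
    (a * b).map φ = a.map φ * b.map φ := by
  ext X x y
  change φ (⨆ z, a.val X x z ⊓ b.val X z y) = ⨆ z, φ (a.val X x z) ⊓ φ (b.val X z y)
  simp only [map_iSup, map_inf]

end ValuedAut

/-- The generic automorphism of `F`, with values in `lAut(F)`. -/
def genericAut : ValuedAut F (LAutFrame F) where
  val X x y := lAutGen X x y
  natural {X Y} f x y := by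
    refine sharp_le.2 (LowerSet.lower _ ?_ (sharp_le.1 le_rfl))
    exact FreeInf.gen_mono ⟨f, rfl, rfl⟩
  univalued X x y z h := by
    refine bot_unique ?_
    have := sharp_cov (AutCov.univalued X x y z h)
    simpa [sharp_inf, lAutGen] using this
  injective X x y z h := by
    refine bot_unique ?_
    have := sharp_cov (AutCov.injective X x y z h)
    simpa [sharp_inf, lAutGen] using this
  total X z := top_unique (by
    have := sharp_cov (AutCov.total X z)
    rwa [sharp_top, iSup_range] at this)
  surjective X z := top_unique (by
    have := sharp_cov (AutCov.surjective X z)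
    rwa [sharp_top, iSup_range] at this)

variable {F} in
lemma ValuedAut.monotone_val {H : Type w} [Order.Frame H] (a : ValuedAut F H) :
    Monotone fun p : RelPoset F => a.val p.1 p.2.1 p.2.2 := by
  rintro ⟨X, x, y⟩ ⟨Y, x', y'⟩ ⟨f, h₁, h₂⟩
  change a.val X x y ≤ a.val Y x' y'
  rw [← show _ = x' from h₁, ← show _ = y' from h₂]
  exact a.natural f x y

variable {F} in
/-- The inf-preserving map `𝒟(D_{ΔF}) → H` determined by an `H`-valued automorphism of `F`. -/
def ValuedAut.point {H : Type w} [Order.Frame H] (a : ValuedAut F H) :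
    FreeInf (RelPoset F) → H :=
  FreeInf.ext fun p : RelPoset F => a.val p.1 p.2.1 p.2.2

variable {F} in
lemma ValuedAut.point_relGen {H : Type w} [Order.Frame H] (a : ValuedAut F H) (X : C)
    (x y : F.obj X) : a.point (relGen X x y) = a.val X x y :=
  FreeInf.ext_gen a.monotone_val _

variable {F} in
lemma ValuedAut.point_cov {H : Type w} [Order.Frame H] (a : ValuedAut F H)
    (U : FreeInf (RelPoset F)) (S : Set (FreeInf (RelPoset F))) (h : AutCov F U S) :
    a.point U ≤ ⨆ s ∈ S, a.point s := by
  have hinf : ∀ U V, a.point (U ⊓ V) = a.point U ⊓ a.point V := FreeInf.ext_inf _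
  obtain ⟨X, x, y, z, h⟩ | ⟨X, x, y, z, h⟩ | ⟨X, z⟩ | ⟨X, z⟩ := h
  · simp [hinf, point_relGen, a.univalued X x y z h]
  · simp [hinf, point_relGen, a.injective X x y z h]
  · rw [iSup_range]; simp only [point_relGen, a.total, le_top]
  · rw [iSup_range]; simp only [point_relGen, a.surjective, le_top]

variable {F} in
/-- The morphism of locales `lAut(F) → H` classifying an `H`-valued automorphism of `F`. -/
def classify {H : Type w} [Order.Frame H] (a : ValuedAut F H) : FrameHom (LAutFrame F) H :=
  liftSheaves a.point (FreeInf.ext_inf _) (FreeInf.ext_top _) a.point_cov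

variable {F} in
lemma classify_lAutGen {H : Type w} [Order.Frame H] (a : ValuedAut F H) (X : C) (x y : F.obj X) :
    classify a (lAutGen X x y) = a.val X x y :=
  (liftSheaves_sharp _ _ _ _ _).trans (a.point_relGen X x y)

variable {F} in
lemma lAut_hom_ext {H : Type w} [Order.Frame H] {φ ψ : FrameHom (LAutFrame F) H}
    (h : ∀ X x y, φ (lAutGen X x y) = ψ (lAutGen X x y)) : φ = ψ := by
  refine frameHom_ext_sharp fun U => ?_
  induction U using FreeInf.induction with
  | top => rw [sharp_top, map_top, map_top]
  | inf p U ih =>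
    rw [sharp_inf, map_inf, map_inf, ih]
    congr 1
    exact h p.1 p.2.1 p.2.2

/-- Frame morphisms out of `lAut(F)` are the same as automorphisms of `F` valued in a frame. -/
def lAutEquiv (H : Type w) [Order.Frame H] : FrameHom (LAutFrame F) H ≃ ValuedAut F H where
  toFun φ := (genericAut F).map φ
  invFun := classify
  left_inv _ := lAut_hom_ext fun X x y => classify_lAutGen _ X x y
  right_inv a := ValuedAut.ext (funext fun X => funext fun x => funext fun y =>
    classify_lAutGen a X x y)

/-- The presheaf of groups on localic spaces which sends `H` to the group of `H`-valued
automorphisms of `F`. -/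
noncomputable def valuedAutFunctor : LocalicSpace.{max u v}ᵒᵖ ⥤ GrpCat.{max u v} where
  obj H := GrpCat.of (ValuedAut F H.unop.unop)
  map f := GrpCat.ofHom (MonoidHom.mk' (ValuedAut.map (invImage f.unop))
    (ValuedAut.map_mul (invImage f.unop)))

/-- The localic space `lAut(F)` represents `valuedAutFunctor F`. -/
noncomputable def lAutRepresentable : (valuedAutFunctor F ⋙ forget GrpCat).RepresentableBy (lAut F) where
  homEquiv {H} :=
    { toFun := fun f => (genericAut F).map (invImage f)
      invFun := fun a => ofInvImage (classify a)
      left_inv := fun f => locale_hom_ext ((lAutEquiv F H.unop).left_inv (invImage f))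
      right_inv := fun a => (lAutEquiv F H.unop).right_inv a }
  homEquiv_comp _ _ := rfl

/-- The group structure of the localic space `lAut(F)`. Its multiplication is characterized by
`m^*[(X, <x | y>)] = ⋁_z [(X, <x | z>)] ⊗ [(X, <z | y>)]`, its neutral element by
`e^*[(X, <x | y>)] = 1` if `x = y`, and `0` otherwise. -/
noncomputable instance : GrpObj (lAut F) :=
  GrpObj.ofRepresentableBy (lAut F) (valuedAutFunctor F) (lAutRepresentable F)

end LAut

/-! ### Actions of localic groups on sets and the classifying topos -/

section GSets

open MonoidalCategory CartesianMonoidalCategory MonObj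

/-- The localic group `lAut(X)` of automorphisms of a set `X`, that is, of the functor on the
one-arrow category with value `X`: here `D_{ΔF}` is the set `X × X` with the discrete order. The
universe parameter `u` only serves to place `lAut(X)` in a universe large enough. -/
abbrev lAutSet (X : Type v) : LocalicSpace.{max u v} :=
  lAut (Functor.fromPUnit.{u} X)

/-- The generator `[<x | y>]` of the locale `lAut(X)`. -/
def setGen {X : Type v} (x y : X) : (lAutSet.{v, u} X).unop :=
  lAutGen (F := Functor.fromPUnit.{u} X) ⟨PUnit.unit⟩ x y

/-- A `G`-set: a set `X` with an action of the localic group `G`, that is, a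
morphism of localic groups `G ⟶ lAut(X)`. -/
structure GSet (G : LocalicSpace.{max u v}) [GrpObj G] where
  carrier : Type v
  action : G ⟶ lAutSet.{v, u} carrier
  [isMonHom_action : IsMonHom action]

namespace GSet

variable {G : LocalicSpace.{max u v}} [GrpObj G]

/-- The element `μ^*[<x | y>]` of `G`, described informally as `{g | g x = y}`. -/
def act (S : GSet.{v, u} G) (x y : S.carrier) : G.unop :=
  invImage S.action (setGen x y)

/-- A morphism of `G`-sets. -/
@[ext]
structure Hom (S T : GSet.{v, u} G) where
  toFun : S.carrier → T.carrier
  act_le : ∀ x y, S.act x y ≤ T.act (toFun x) (toFun y)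

/-- The category `ℬG` of `G`-sets. -/
instance : Category.{v} (GSet.{v, u} G) where
  Hom := Hom
  id S := ⟨id, fun _ _ => le_rfl⟩
  comp f g := ⟨g.toFun ∘ f.toFun, fun x y => (f.act_le x y).trans (g.act_le _ _)⟩

/-- The action is transitive if no `μ^*[<x | y>]` is `0`. -/
def IsTransitive (S : GSet.{v, u} G) : Prop := ∀ x y, S.act x y ≠ ⊥

variable (G) in
/-- The objects of the full subcategory `tℬG` of nonempty transitive `G`-sets. -/
def nonemptyTransitive : ObjectProperty (GSet.{v, u} G) :=
  fun S => Nonempty S.carrier ∧ S.IsTransitive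

end GSet

variable {C : Type u} [Category.{v₁} C] (F : C ⥤ Type v)

variable {F} in
/-- The component at `X` of an `H`-valued automorphism of `F`. -/
def ValuedAut.component {H : Type w} [Order.Frame H] (a : ValuedAut F H) (X : C) :
    ValuedAut (Functor.fromPUnit.{u} (F.obj X)) H where
  val _ x y := a.val X x y
  natural _ _ _ := le_rfl
  univalued _ := a.univalued X
  injective _ := a.injective X
  total _ := a.total X
  surjective _ := a.surjective X

variable {F} in
/-- The `H`-valued automorphism of `F` classified by a continuous map `H ⟶ lAut(F)`. -/
def autOfHom {H : LocalicSpace.{max u v}} (f : H ⟶ lAut F) : ValuedAut F H.unop :=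
  (genericAut F).map (invImage f)

variable {F} in
lemma autOfHom_injective {H : LocalicSpace.{max u v}} {f g : H ⟶ lAut F}
    (h : autOfHom f = autOfHom g) : f = g :=
  (lAutRepresentable F).homEquiv.injective h

variable {F} in
lemma autOfHom_comp {H K : LocalicSpace.{max u v}} (f : H ⟶ K) (g : K ⟶ lAut F) :
    autOfHom (f ≫ g) = (autOfHom g).map (invImage f) := rfl

lemma autOfHom_one : autOfHom (η[lAut F]) = 1 :=
  (lAutRepresentable F).homEquiv.apply_symm_apply _

lemma autOfHom_mul :
    autOfHom (μ[lAut F]) = autOfHom (fst (lAut F) (lAut F)) * autOfHom (snd (lAut F) (lAut F)) :=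
  (lAutRepresentable F).homEquiv.apply_symm_apply _

lemma invImage_mul (X : C) (x y : F.obj X) :
    invImage (μ[lAut F]) (lAutGen X x y) =
      ⨆ z, sharp (TensorCov (LAutFrame F) (LAutFrame F)) (lAutGen X x z, lAutGen X z y) := by
  simp only [sharp_eq_inl_inf_inr]
  exact congrArg (fun a => a.val X x y) (autOfHom_mul F)

/-- The morphism of localic groups `lAut(F) ⟶ lAut(FX)` with inverse image
`[<x₀ | x₁>] ↦ #[(X, <x₀ | x₁>)]`. -/
def evalAut (X : C) : lAut F ⟶ lAutSet.{v, u} (F.obj X) :=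
  ofInvImage (classify ((genericAut F).component X))

lemma autOfHom_comp_evalAut {H : LocalicSpace.{max u v}} (f : H ⟶ lAut F) (X : C) :
    autOfHom (f ≫ evalAut F X) = (autOfHom f).component X :=
  ValuedAut.ext (funext fun Y => funext fun x => funext fun y =>
    congrArg (invImage f) (classify_lAutGen ((genericAut F).component X) Y x y))

lemma component_map {H : Type w} [Order.Frame H] {K : Type w'} [Order.Frame K]
    (φ : FrameHom H K) (a : ValuedAut F H) (X : C) :
    (a.map φ).component X = (a.component X).map φ := rfl

instance (X : C) : IsMonHom (evalAut F X) where
  one_hom := autOfHom_injective (by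
    rw [autOfHom_comp_evalAut, autOfHom_one, autOfHom_one]
    rfl)
  mul_hom := autOfHom_injective (by
    rw [autOfHom_comp_evalAut, autOfHom_mul, autOfHom_comp, autOfHom_mul, ValuedAut.map_mul,
      ← autOfHom_comp, ← autOfHom_comp, tensorHom_fst, tensorHom_snd, autOfHom_comp_evalAut,
      autOfHom_comp_evalAut]
    rfl)

lemma invImage_evalAut (X : C) (x y : F.obj X) :
    invImage (evalAut F X) (setGen x y) = lAutGen X x y :=
  classify_lAutGen ((genericAut F).component X) _ x y

/-- The lift `μF : C ⥤ ℬG`, for `G = lAut(F)`, of a set-valued functor `F`. -/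
def muF : C ⥤ GSet.{v, u} (lAut F) where
  obj X := { carrier := F.obj X, action := evalAut F X }
  map {X Y} f := ⟨fun x => F.map f x, fun x y => by
    change invImage (evalAut F X) (setGen x y) ≤
      invImage (evalAut F Y) (setGen (F.map f x) (F.map f y))
    rw [invImage_evalAut, invImage_evalAut]
    exact (genericAut F).natural f x y⟩
  map_id X := GSet.Hom.ext (funext fun x => by simp; rfl)
  map_comp f g := GSet.Hom.ext (funext fun x => by simp; rfl)

end GSets

/-! ### Prorepresentable functors, and sheaf topoi -/

section Topos

variable {C : Type u} [Category.{v} C]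

/-- `F` is prorepresentable: `F = [P, -] = colim_i [P_i, -]` for a pro-object `P = (P_i)` of `C`
indexed by a small cofiltered category. -/
def IsProrepresentable (F : C ⥤ Type v) : Prop :=
  ∃ (I : Type v) (_ : SmallCategory I) (_ : IsCofiltered I) (P : I ⥤ C),
    Nonempty (colimit (P.op ⋙ coyoneda) ≅ F)

/-- The functor `L : C ⥤ E` induces an equivalence between the category of
sheaves of sets on `C` for the topology `J` and `E`: there is an equivalence `e` whose inverse is
`S ↦ Hom_E(L(-), S)`, and which sends the presheaf represented by `X` to `L(X)`. -/
def InducesEquivalence (J : GrothendieckTopology C) {E : Type w} [Category.{v} E]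
    (L : C ⥤ E) : Prop :=
  ∃ e : Sheaf J (Type v) ≌ E,
    Nonempty (e.inverse ⋙ sheafToPresheaf J (Type v) ≅
      yoneda ⋙ (Functor.whiskeringLeft Cᵒᵖ Eᵒᵖ (Type v)).obj L.op) ∧
    Nonempty (L ⋙ e.inverse ⋙ sheafToPresheaf J (Type v) ≅ yoneda)

end Topos

end LocalicGalois

universe v u

open CategoryTheory LocalicGalois

/-!
Elements of fibres of `F` form a codirected category, and all transition maps of `F` are surjective,
so `lAut(F)` has a model in which its generators can be compared: the closed downsets of `D_{ΔF}`.
There no generator vanishes, which gives transitivity, and one generator lies below another only if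
it does so in `D_{ΔF}`, which makes `μF` full and faithful.

For an element `s` of a `G`-set, evaluating `μ^*[⟨s|s⟩]` at the unit of `G` yields `z ∈ FZ` whose
stabilizer is contained in that of `s`, hence a morphism `μF(Z) ⟶ S` which sends `z` to `s`. So the
`μF(Z)` determine `S` through the atomic sheaf `S ↦ ℬG(μF(-), S)`. Conversely `F` is a point of the
atomic site, and `G` acts on the stalk of a sheaf at this point through its action on the fibres;
the sheaf is recovered as the morphisms from the `μF(X)` to its stalk. Finally a canonical covering
sieve can be empty only if `C` is the point, so that otherwise the canonical topology is the atomic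
one.
-/

universe v₁ w

namespace LocalicGalois

open Limits Opposite

section Prorepresentable

variable {C : Type u} [Category.{v} C]

/-- For `P : I ⥤ C`, the functor `[P, -]` in the form in which Mathlib constructs fibre functors
of points of sites. -/
noncomputable def colimitCoyonedaIsoFiber {I : Type v} [SmallCategory I] [InitiallySmall.{v} I]
    (P : I ⥤ C) :
    colimit (P.op ⋙ coyoneda) ≅ GrothendieckTopology.Point.ofIsCofiltered.fiber.{v} P :=
  colimitIsoFlipCompColim (P.op ⋙ coyoneda) ≪≫
    Functor.isoWhiskerRight shrinkYonedaIsoYoneda.symm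
      ((Functor.whiskeringLeft _ _ (Type v)).obj P.op ⋙ colim)

lemma IsProrepresentable.isCofiltered_and_initiallySmall {F : C ⥤ Type v}
    (hF : IsProrepresentable F) : IsCofiltered F.Elements ∧ InitiallySmall.{v} F.Elements := by
  obtain ⟨I, _, _, P, ⟨e⟩⟩ := hF
  have := initiallySmall_of_essentiallySmall.{v} I
  let elementsEquiv :
      (GrothendieckTopology.Point.ofIsCofiltered.fiber.{v} P).Elements ≌ F.Elements :=
    Cat.equivOfIso (Functor.elementsFunctor.mapIso ((colimitCoyonedaIsoFiber P).symm ≪≫ e))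
  exact ⟨IsCofiltered.of_equivalence elementsEquiv,
    initiallySmall_of_initial_of_initiallySmall elementsEquiv.functor⟩

end Prorepresentable

section CodirectedElements

variable {C : Type u} [Category.{v₁} C] (F : C ⥤ Type v)

section

variable [IsCofiltered F.Elements]

lemma exists_map_eq_map_eq {X Y : C} (x : F.obj X) (y : F.obj Y) :
    ∃ (Z : C) (z : F.obj Z) (f : Z ⟶ X) (g : Z ⟶ Y), F.map f z = x ∧ F.map g z = y :=
  let p := F.elementsMk X x
  let q := F.elementsMk Y y
  ⟨_, (IsCofiltered.min p q).2, (IsCofiltered.minToLeft p q).1, (IsCofiltered.minToRight p q).1,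
    (IsCofiltered.minToLeft p q).2, (IsCofiltered.minToRight p q).2⟩

variable {F}

lemma exists_map_eq_comp_eq {X Y Z : C} (f : X ⟶ Z) (g : Y ⟶ Z) {x : F.obj X} {y : F.obj Y}
    (h : F.map f x = F.map g y) :
    ∃ (W : C) (w : F.obj W) (a : W ⟶ X) (b : W ⟶ Y),
      a ≫ f = b ≫ g ∧ F.map a w = x ∧ F.map b w = y := by
  obtain ⟨W, a, b, hab⟩ := IsCofiltered.cospan
    (CategoryOfElements.homMk (F.elementsMk X x) (F.elementsMk Z (F.map g y)) f h)
    (CategoryOfElements.homMk (F.elementsMk Y y) (F.elementsMk Z (F.map g y)) g rfl)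
  exact ⟨W.1, W.2, a.1, b.1, congrArg Subtype.val hab, a.2, b.2⟩

lemma exists_map_eq_comp_eq_comp {X Y : C} (f g : X ⟶ Y) {x : F.obj X}
    (h : F.map f x = F.map g x) :
    ∃ (W : C) (w : F.obj W) (a : W ⟶ X), a ≫ f = a ≫ g ∧ F.map a w = x :=
  let p := F.elementsMk X x
  let q := F.elementsMk Y (F.map g x)
  let φ : p ⟶ q := CategoryOfElements.homMk p q f h
  let ψ : p ⟶ q := CategoryOfElements.homMk p q g rfl
  ⟨(IsCofiltered.eq φ ψ).1, (IsCofiltered.eq φ ψ).2, (IsCofiltered.eqHom φ ψ).1,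
    congrArg Subtype.val (IsCofiltered.eq_condition φ ψ), (IsCofiltered.eqHom φ ψ).2⟩

lemma hom_eq_of_map_eq [∀ {X Y : C} (f : X ⟶ Y), EffectiveEpi f] {X Y : C} {f g : X ⟶ Y}
    (x : F.obj X) (h : F.map f x = F.map g x) : f = g := by
  obtain ⟨W, -, a, hfg, -⟩ := exists_map_eq_comp_eq_comp f g h
  exact (cancel_epi a).1 hfg

end

variable {F} in
lemma map_surjective [∀ {X Y : C} (f : X ⟶ Y), Epi (F.map f)] {X Y : C} (f : X ⟶ Y) :
    Function.Surjective (F.map f) :=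
  (epi_iff_surjective _).1 inferInstance

lemma rightOreCondition [IsCofiltered F.Elements] [∀ {X Y : C} (f : X ⟶ Y), Epi (F.map f)]
    [∀ X, Nonempty (F.obj X)] : GrothendieckTopology.RightOreCondition C := by
  intro X Y Z f g
  obtain ⟨z, hz⟩ := map_surjective g (F.map f (Classical.arbitrary (F.obj Y)))
  obtain ⟨W, -, a, b, hab, -⟩ := exists_map_eq_comp_eq f g hz.symm
  exact ⟨W, a, b, hab⟩

end CodirectedElements

section Atomic

variable {C : Type u} [Category.{v} C]

lemma isSheaf_atomic_iff (hro : GrothendieckTopology.RightOreCondition C) (P : Cᵒᵖ ⥤ Type w) :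
    Presieve.IsSheaf (GrothendieckTopology.atomic hro) P ↔
      ∀ ⦃X Y : C⦄ (f : Y ⟶ X), (Presieve.singleton f).IsSheafFor P := by
  refine ⟨fun h X Y f => ?_, fun h X S ⟨Y, f, hf⟩ x hx => ?_⟩
  · rw [Presieve.isSheafFor_iff_generate]
    exact h _ ⟨Y, f, Sieve.le_generate _ _ _ ⟨⟩⟩
  · obtain ⟨p, hp, huniq⟩ := Presieve.isSheafFor_singleton.1 (h f) (x f hf)
      (fun {V} s t hst => hx s t hf hf hst)
    refine ⟨p, fun Z g hg => ?_, fun q hq => huniq q (hq f hf)⟩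
    obtain ⟨W, a, b, hab⟩ := hro g f
    refine Presieve.isSeparatedFor_singleton.1 (h a).isSeparatedFor ?_
    calc P.map a.op (P.map g.op p) = P.map (a ≫ g).op p := by simp
      _ = P.map b.op (P.map f.op p) := by simp [hab]
      _ = P.map a.op (x g hg) := by rw [hp, hx a b hg hf hab]

variable [∀ {X Y : C} (f : X ⟶ Y), EffectiveEpi f]

lemma atomic_le_canonicalTopology (hro : GrothendieckTopology.RightOreCondition C) :
    GrothendieckTopology.atomic hro ≤ Sheaf.canonicalTopology C :=
  (GrothendieckTopology.Subcanonical.of_isSheaf_yoneda_obj _ fun _ =>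
    (isSheaf_atomic_iff hro _).2 fun _ _ f =>
      Presieve.IsSheafFor.singleton_of_isRepresentable_of_effectiveEpi f _).le_canonical

omit [∀ {X Y : C} (f : X ⟶ Y), EffectiveEpi f] in
lemma nonempty_isInitial_of_bot_mem {J : GrothendieckTopology C} [J.Subcanonical] {X : C}
    (h : ⊥ ∈ J X) : Nonempty (IsInitial X) := by
  have existsUnique_hom (Z : C) : ∃! _ : X ⟶ Z, True := by
    obtain ⟨f, -, hf⟩ := GrothendieckTopology.Subcanonical.isSheaf_of_isRepresentable (J := J)
      (yoneda.obj Z) _ h (fun _ _ h => h.elim) (fun _ _ _ _ _ _ _ h => h.elim)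
    exact ⟨f, trivial, fun g _ => hf g fun _ _ h => h.elim⟩
  choose f _ hf using existsUnique_hom
  exact ⟨IsInitial.ofUniqueHom f fun Z g => hf Z g trivial⟩

omit [∀ {X Y : C} (f : X ⟶ Y), EffectiveEpi f] in
lemma nonempty_isInitial_of_hom_of_bot_mem {J : GrothendieckTopology C} [J.Subcanonical]
    {X Y : C} (h : ⊥ ∈ J X) (f : Y ⟶ X) : Nonempty (IsInitial Y) :=
  nonempty_isInitial_of_bot_mem (by simpa using J.pullback_stable f h)

lemma nonempty_equivalence_punit_of_bot_mem {J : GrothendieckTopology C} [J.Subcanonical]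
    {X : C} (h : ⊥ ∈ J X) : Nonempty (C ≌ Discrete PUnit.{1}) := by
  obtain ⟨hX⟩ := nonempty_isInitial_of_bot_mem h
  have nonempty_hom (Z : C) : Nonempty (Z ⟶ X) :=
    ⟨EffectiveEpi.desc (hX.to Z) (𝟙 X) fun s _ _ =>
      (nonempty_isInitial_of_hom_of_bot_mem h s).some.hom_ext _ _⟩
  have isInitial (Z : C) : Nonempty (IsInitial Z) :=
    nonempty_isInitial_of_hom_of_bot_mem h (nonempty_hom Z).some
  exact (equiv_punit_iff_unique C).2 ⟨⟨X⟩, fun Y Z => ⟨⟨⟨(isInitial Y).some.to Z⟩,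
    fun f => (isInitial Y).some.hom_ext f _⟩⟩⟩

lemma atomic_eq_canonicalTopology (hro : GrothendieckTopology.RightOreCondition C)
    (hC : ¬ Nonempty (C ≌ Discrete PUnit.{1})) :
    GrothendieckTopology.atomic hro = Sheaf.canonicalTopology C := by
  refine le_antisymm (atomic_le_canonicalTopology hro) fun X S hS => ?_
  by_contra hempty
  obtain rfl : S = ⊥ := le_bot_iff.1 fun Y f hf => hempty ⟨Y, f, hf⟩
  exact hC (nonempty_equivalence_punit_of_bot_mem hS)

end Atomic

section Dense

variable {C : Type u} [Category.{v₁} C] {F : C ⥤ Type v}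

lemma mem_himp_iff_forall_le {α : Type w} [Preorder α] {S T : LowerSet α} {a : α} :
    a ∈ S ⇨ T ↔ ∀ b ≤ a, b ∈ S → b ∈ T := by
  rw [← LowerSet.Iic_le, le_himp_iff]
  exact ⟨fun h b hb hS => h ⟨hb, hS⟩, fun h b hb => h b hb.1 hb.2⟩

/-- The element `⟨X, (x, y)⟩` of `D_{ΔF}`. -/
abbrev relPt (X : C) (x y : F.obj X) : RelPoset F := ⟨X, (x, y)⟩

variable (F) in
/-- The involution of `D_{ΔF}` which exchanges the two elements of a pair. It reduces statements
about injectivity and surjectivity to statements about univaluedness and totality. -/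
def relSwap : RelPoset F ≃o RelPoset F where
  toFun p := ⟨p.1, p.2.swap⟩
  invFun p := ⟨p.1, p.2.swap⟩
  left_inv _ := rfl
  right_inv _ := rfl
  map_rel_iff' := exists_congr fun _ => and_comm

lemma relSwap_relPt (X : C) (x y : F.obj X) : relSwap F (relPt X x y) = relPt X y x := rfl

lemma relPt_mem_map_relSwap {T : LowerSet (RelPoset F)} {X : C} {x y : F.obj X} :
    relPt X x y ∈ LowerSet.map (relSwap F) T ↔ relPt X y x ∈ T :=
  LowerSet.mem_map

/-- The sheaf condition on a downward closed subset of `D_{ΔF}` for the families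
`⟨W, (w, w')⟩ ⟶ ⟨Z, (F(f)(w), z)⟩`, where `f : W ⟶ Z` and `w` are fixed and `w'` ranges over the
fibre of `z`. -/
def IsFiberClosed (T : LowerSet (RelPoset F)) : Prop :=
  ∀ ⦃W Z : C⦄ (f : W ⟶ Z) (w : F.obj W) (z : F.obj Z),
    (∀ w', F.map f w' = z → relPt W w w' ∈ T) → relPt Z (F.map f w) z ∈ T

lemma IsFiberClosed.sInf {A : Set (LowerSet (RelPoset F))} (hA : ∀ T ∈ A, IsFiberClosed T) :
    IsFiberClosed (InfSet.sInf A) := by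
  intro W Z f w z h
  simp only [LowerSet.mem_sInf_iff] at h ⊢
  exact fun T hT => hA T hT f w z fun w' hw' => h w' hw' T hT

lemma isFiberClosed_bot [∀ {X Y : C} (f : X ⟶ Y), Epi (F.map f)] :
    IsFiberClosed (⊥ : LowerSet (RelPoset F)) := by
  intro W Z f w z h
  obtain ⟨w', hw'⟩ := map_surjective f z
  exact LowerSet.notMem_bot (h w' hw')

variable [IsCofiltered F.Elements]

lemma IsFiberClosed.himp (S : LowerSet (RelPoset F)) {T : LowerSet (RelPoset F)}
    (hT : IsFiberClosed T) : IsFiberClosed (S ⇨ T) := by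
  intro W Z f w z h
  rw [mem_himp_iff_forall_le]
  rintro ⟨V, v, v'⟩ ⟨(g : V ⟶ Z), (hv : F.map g v = F.map f w), hv'⟩ hS
  obtain ⟨U, u, a, b, hab, rfl, rfl⟩ := exists_map_eq_comp_eq g f hv
  refine hT a u v' fun u' hu' => ?_
  have hb : F.map f (F.map b u') = z := by
    rw [← Functor.map_comp_apply, ← hab, Functor.map_comp_apply, hu']
    exact hv'
  exact mem_himp_iff_forall_le.1 (h (F.map b u') hb) _ ⟨b, rfl, rfl⟩ (S.lower ⟨a, rfl, hu'⟩ hS)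

lemma IsFiberClosed.Iic_inf_Iic_le {T : LowerSet (RelPoset F)} (hT : IsFiberClosed T) {X : C}
    {x y : F.obj X} (z : F.obj X) (h : x ≠ y) :
    LowerSet.Iic (relPt X z x) ⊓ LowerSet.Iic (relPt X z y) ≤ T := by
  rintro ⟨Y, a, b⟩ ⟨⟨(f : Y ⟶ X), (hfa : F.map f a = z), hfb⟩,
    ⟨(g : Y ⟶ X), (hga : F.map g a = z), hgb⟩⟩
  obtain ⟨W, w, e, he, rfl⟩ := exists_map_eq_comp_eq_comp f g (hfa.trans hga.symm)
  refine hT e w b fun w' hw' => (h ?_).elim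
  calc x = F.map f (F.map e w') := by rw [hw']; exact hfb.symm
    _ = F.map g (F.map e w') := by
      rw [← Functor.map_comp_apply, he, Functor.map_comp_apply]
    _ = y := by rw [hw']; exact hgb

lemma IsFiberClosed.eq_top {T : LowerSet (RelPoset F)} (hT : IsFiberClosed T) {X : C}
    {z : F.obj X} (h : ∀ x, relPt X z x ∈ T) : T = ⊤ := by
  refine top_unique fun ⟨Y, y, y'⟩ _ => ?_
  obtain ⟨W, w, f, g, rfl, rfl⟩ := exists_map_eq_map_eq F y z
  exact hT f w y' fun w' _ => T.lower ⟨g, rfl, rfl⟩ (h (F.map g w'))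

variable (F) in
/-- The locale of downward closed subsets of `D_{ΔF}` satisfying the sheaf condition of
`IsFiberClosed` in both variables. It is the target of `relAut`, which detects that the generators
of `lAut(F)` are nonzero and how they are ordered. -/
def relSheaves : Sublocale (LowerSet (RelPoset F)) where
  carrier := {T | IsFiberClosed T ∧ IsFiberClosed (LowerSet.map (relSwap F) T)}
  sInf_mem' A hA := by
    refine ⟨.sInf fun T hT => (hA hT).1, ?_⟩
    rw [map_sInf]
    exact .sInf (Set.forall_mem_image.2 fun T hT => (hA hT).2)
  himp_mem' S T hT := by
    refine ⟨.himp S hT.1, ?_⟩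
    rw [map_himp]
    exact .himp _ hT.2

/-- The associated sheaf of the downward closed subset of `D_{ΔF}` represented by `p`. -/
def relSharp (p : RelPoset F) : relSheaves F :=
  (relSheaves F).restrict (LowerSet.Iic p)

lemma restrict_relSheaves_le {S : LowerSet (RelPoset F)} {T : relSheaves F} :
    (relSheaves F).restrict S ≤ T ↔ S ≤ T.1 :=
  (relSheaves F).giRestrict.gc _ _

lemma relSharp_le {p : RelPoset F} {T : relSheaves F} : relSharp p ≤ T ↔ p ∈ T.1 :=
  restrict_relSheaves_le.trans LowerSet.Iic_le

lemma relSharp_inf_relSharp_eq_bot {p q : RelPoset F}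
    (h : ∀ T ∈ relSheaves F, LowerSet.Iic p ⊓ LowerSet.Iic q ≤ T) :
    relSharp p ⊓ relSharp q = ⊥ := by
  rw [relSharp, relSharp, ← map_inf]
  exact bot_unique (restrict_relSheaves_le.2 (h _ (⊥ : relSheaves F).2))

lemma iSup_relSharp_eq_top {ι : Type w} {p : ι → RelPoset F}
    (h : ∀ T ∈ relSheaves F, (∀ i, p i ∈ T) → T = ⊤) : ⨆ i, relSharp (p i) = ⊤ :=
  Subtype.ext (h _ (⨆ i, relSharp (p i)).2 fun i =>
    relSharp_le.1 (le_iSup (fun i => relSharp (p i)) i))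

variable (F) in
/-- The automorphism of `F` with values in `relSheaves F` given by the representables. -/
def relAut : ValuedAut F (relSheaves F) where
  val X x y := relSharp (relPt X x y)
  natural f x y := relSharp_le.2
    ((relSharp _).1.lower ⟨f, rfl, rfl⟩ (relSharp_le.1 le_rfl))
  univalued X x y z h := relSharp_inf_relSharp_eq_bot fun T hT => hT.1.Iic_inf_Iic_le z h
  injective X x y z h := relSharp_inf_relSharp_eq_bot fun T hT => by
    have := hT.2.Iic_inf_Iic_le z h
    rw [← (LowerSet.map (relSwap F)).le_iff_le, map_inf]
    simpa only [LowerSet.map_Iic, relSwap_relPt] using this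
  total X z := iSup_relSharp_eq_top fun T hT h => hT.1.eq_top h
  surjective X z := iSup_relSharp_eq_top fun T hT h =>
    (LowerSet.map (relSwap F)).injective <|
      (hT.2.eq_top fun x => relPt_mem_map_relSwap.2 (h x)).trans (map_top _).symm

section

variable [∀ {X Y : C} (f : X ⟶ Y), Epi (F.map f)]

lemma lAutGen_ne_bot {X : C} (x y : F.obj X) : lAutGen X x y ≠ ⊥ := by
  intro h
  have hbot : (⊥ : LowerSet (RelPoset F)) ∈ relSheaves F :=
    ⟨isFiberClosed_bot, by rw [map_bot]; exact isFiberClosed_bot⟩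
  have hsharp : relSharp (relPt X x y) = ⊥ := by
    rw [← map_bot (classify (relAut F)), ← h, classify_lAutGen]; rfl
  exact relSharp_le.1 (hsharp.trans_le (bot_le (a := (⟨⊥, hbot⟩ : relSheaves F))))

variable [∀ {X Y : C} (f : X ⟶ Y), EffectiveEpi f]

lemma exists_comp_eq_of_constant_on_fiber {W Y Z : C} (f : W ⟶ Z) (g : W ⟶ Y) (z : F.obj Z)
    (y : F.obj Y) (h : ∀ w, F.map f w = z → F.map g w = y) : ∃ k : Z ⟶ Y, f ≫ k = g := by
  refine ⟨EffectiveEpi.desc f g fun {V} s t hst => ?_, EffectiveEpi.fac _ _ _⟩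
  obtain ⟨v, hv⟩ := map_surjective (s ≫ f) z
  refine hom_eq_of_map_eq v ?_
  rw [Functor.map_comp_apply, Functor.map_comp_apply, h _ (by simpa using hv),
    h _ (by simpa [hst] using hv)]

lemma isFiberClosed_Iic (p : RelPoset F) : IsFiberClosed (LowerSet.Iic p) := by
  intro W Z f w z h
  obtain ⟨w₀, hw₀⟩ := map_surjective f z
  obtain ⟨g, hg, hg₀⟩ := h w₀ hw₀
  obtain ⟨k, rfl⟩ := exists_comp_eq_of_constant_on_fiber f g z p.2.2 fun w' hw' => by
    obtain ⟨g', hg', hw'⟩ := h w' hw'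
    obtain rfl : g = g' := hom_eq_of_map_eq w (hg.trans hg'.symm)
    exact hw'
  exact ⟨k, by simpa using hg, by simpa [← hw₀] using hg₀⟩

lemma exists_hom_of_lAutGen_le {X Y : C} {x x' : F.obj X} {y y' : F.obj Y}
    (h : lAutGen X x x' ≤ lAutGen Y y y') : ∃ f : X ⟶ Y, F.map f x = y ∧ F.map f x' = y' := by
  have hIic : LowerSet.Iic (relPt Y y y') ∈ relSheaves F :=
    ⟨isFiberClosed_Iic _, by rw [LowerSet.map_Iic]; exact isFiberClosed_Iic _⟩
  have hsharp : relSharp (relPt X x x') ≤ relSharp (relPt Y y y') := by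
    have := OrderHomClass.mono (classify (relAut F)) h
    rwa [classify_lAutGen, classify_lAutGen] at this
  exact relSharp_le.1 (hsharp.trans
    (relSharp_le (T := ⟨_, hIic⟩).2 (LowerSet.mem_Iic_iff.2 le_rfl)))

end

end Dense

section Basis

variable {C : Type u} [Category.{v₁} C] {F : C ⥤ Type v}

lemma ValuedAut.val_le_iSup_fiber {H : Type w} [Order.Frame H] (a : ValuedAut F H) {X Z : C}
    (f : Z ⟶ X) (z : F.obj Z) (x : F.obj X) :
    a.val X (F.map f z) x ≤ ⨆ (z' : F.obj Z) (_ : F.map f z' = x), a.val Z z z' := by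
  rw [← inf_top_eq (a.val X (F.map f z) x), ← a.total Z z, inf_iSup_eq]
  refine iSup_le fun z' => ?_
  by_cases h : F.map f z' = x
  · exact inf_le_right.trans (le_iSup₂_of_le (f := fun z' _ => a.val Z z z') z' h le_rfl)
  · exact ((inf_le_inf_left _ (a.natural f z z')).trans
      (a.univalued X _ _ _ (Ne.symm h)).le).trans bot_le

lemma ValuedAut.val_inf_val_le_iSup_fiber {H : Type w} [Order.Frame H] (a : ValuedAut F H)
    {X Y Z : C} (f : Z ⟶ X) (g : Z ⟶ Y) (z : F.obj Z) (x : F.obj X) (y : F.obj Y) :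
    a.val X (F.map f z) x ⊓ a.val Y (F.map g z) y ≤
      ⨆ (z' : F.obj Z) (_ : F.map f z' = x ∧ F.map g z' = y), a.val Z z z' := by
  refine (inf_le_inf_right _ (a.val_le_iSup_fiber f z x)).trans ?_
  rw [iSup₂_inf_eq]
  refine iSup₂_le fun z' hx => ?_
  by_cases hy : F.map g z' = y
  · exact inf_le_left.trans (le_iSup₂_of_le (f := fun z' _ => a.val Z z z') z' ⟨hx, hy⟩ le_rfl)
  · exact ((inf_le_inf_right _ (a.natural g z z')).trans
      (a.univalued Y _ _ _ hy).le).trans bot_le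

variable [IsCofiltered F.Elements]

lemma sharp_le_of_forall_lAutGen_le {U : FreeInf (RelPoset F)} {T : LAutFrame F}
    (h : ∀ X x y, lAutGen X x y ≤ sharp (AutCov F) U → lAutGen X x y ≤ T) :
    sharp (AutCov F) U ≤ T := by
  induction U using FreeInf.induction generalizing T with
  | top =>
    obtain ⟨Z, z⟩ := IsCofiltered.nonempty (C := F.Elements)
    rw [sharp_top, ← (genericAut F).total Z z]
    exact iSup_le fun z' => h Z z z' (le_top.trans sharp_top.ge)
  | inf p U ih =>
    obtain ⟨X, x, x'⟩ := p
    rw [sharp_inf, ← le_himp_iff']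
    refine ih fun Y y y' hU => le_himp_iff'.2 ?_
    obtain ⟨Z, z, f, g, rfl, rfl⟩ := exists_map_eq_map_eq F x y
    refine ((genericAut F).val_inf_val_le_iSup_fiber f g z x' y').trans (iSup₂_le ?_)
    rintro z' ⟨rfl, rfl⟩
    refine h Z z z' ?_
    rw [sharp_inf]
    exact le_inf ((genericAut F).natural f z z') (((genericAut F).natural g z z').trans hU)

lemma le_of_forall_lAutGen_le {T T' : LAutFrame F}
    (h : ∀ X x y, lAutGen X x y ≤ T → lAutGen X x y ≤ T') : T ≤ T' := by
  rw [eq_iSup_sharp T]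
  exact iSup₂_le fun U hU =>
    sharp_le_of_forall_lAutGen_le fun X x y hxy => h X x y (hxy.trans (sharp_le.2 hU))

lemma eq_iSup_lAutGen (T : LAutFrame F) :
    T = ⨆ (p : RelPoset F) (_ : lAutGen p.1 p.2.1 p.2.2 ≤ T), lAutGen p.1 p.2.1 p.2.2 :=
  le_antisymm
    (le_of_forall_lAutGen_le fun X x y h =>
      le_iSup₂_of_le (f := fun (p : RelPoset F) _ => lAutGen p.1 p.2.1 p.2.2)
        (relPt X x y) h le_rfl)
    (iSup₂_le fun _ h => h)

/-- The elements of a weakly initial family in the category of elements of `F` suffice to generate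
`lAut(F)`. -/
lemma small_lAutFrame [InitiallySmall.{v} F.Elements] : Small.{v} (LAutFrame F) := by
  obtain ⟨s, _, hs⟩ := InitiallySmall.exists_small_weakly_initial_set.{v} F.Elements
  let lower (T : LAutFrame F) : Set (Σ e : s, F.obj e.1.1) :=
    {p | lAutGen p.1.1.1 p.1.1.2 p.2 ≤ T}
  have le_of_lower_subset {T T' : LAutFrame F} (h : lower T ⊆ lower T') : T ≤ T' := by
    refine le_of_forall_lAutGen_le fun X x y hT => ?_
    obtain ⟨⟨Z, z⟩, hZ, ⟨⟨(f : Z ⟶ X), (hf : F.map f z = x)⟩⟩⟩ := hs ⟨X, x⟩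
    obtain rfl := hf
    refine ((genericAut F).val_le_iSup_fiber f z y).trans (iSup₂_le ?_)
    rintro z' rfl
    exact h (a := ⟨⟨_, hZ⟩, z'⟩) (((genericAut F).natural f z z').trans hT)
  exact small_of_injective (f := lower) fun T T' h =>
    (le_of_lower_subset h.subset).antisymm (le_of_lower_subset h.superset)

end Basis

section Cancellation

variable {A B : Type w} [Order.Frame A] [Order.Frame B]

lemma le_of_tensorInl_inf_tensorInr_le_tensorInr {a : A} {b c : B} (ha : a ≠ ⊥)
    (h : tensorInl (B := B) a ⊓ tensorInr b ≤ tensorInr c) : b ≤ c := by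
  let T : Tensor A B := ⟨⟨{p | p.1 = ⊥ ∨ p.2 ≤ c}, fun p q hqp hp =>
    hp.imp (fun h => bot_unique (hqp.1.trans h.le)) hqp.2.trans⟩, by
      rintro _ _ (⟨S, b⟩ | ⟨a, S⟩) ⟨v₁, v₂⟩ hS
      · refine or_iff_not_imp_right.2 fun hb => ?_
        change sSup S ⊓ v₁ = ⊥
        rw [sSup_inf_eq]
        exact bot_unique (iSup₂_le fun a ha => ((hS _ ⟨a, ha, rfl⟩).resolve_right hb).le)
      · refine or_iff_not_imp_left.2 fun ha => ?_
        change sSup S ⊓ v₂ ≤ c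
        rw [sSup_inf_eq]
        exact iSup₂_le fun b hb => (hS _ ⟨b, hb, rfl⟩).resolve_left ha⟩
  have hT : tensorInr c ≤ T := sharp_le.2 (Or.inr le_rfl)
  rw [← sharp_eq_inl_inf_inr] at h
  exact (sharp_le.1 (h.trans hT)).resolve_left ha

lemma le_of_tensorInl_inf_tensorInr_le_tensorInl {a c : A} {b : B} (hb : b ≠ ⊥)
    (h : tensorInl a ⊓ tensorInr b ≤ tensorInl (B := B) c) : a ≤ c := by
  have h' := OrderHomClass.mono (tensorDesc (tensorInr (A := B) (B := A)) tensorInl) h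
  rw [map_inf, tensorDesc_inl, tensorDesc_inl, tensorDesc_inr, inf_comm] at h'
  exact le_of_tensorInl_inf_tensorInr_le_tensorInr hb h'

end Cancellation

section Actions

open MonoidalCategory CartesianMonoidalCategory MonObj

variable {C : Type u} [Category.{v₁} C]

/-- The inverse image of the multiplication of `lAut(F)`. -/
noncomputable def lAutMul (F : C ⥤ Type v) :
    FrameHom (LAutFrame F) (Tensor (LAutFrame F) (LAutFrame F)) :=
  invImage (μ[lAut F])

/-- The inverse image of the neutral element of `lAut(F)`. -/
noncomputable def lAutUnit (F : C ⥤ Type v) : FrameHom (LAutFrame F) (Set PUnit.{max u v + 1}) :=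
  invImage (η[lAut F])

variable {F : C ⥤ Type v}

lemma tensorInl_lAutGen_inf_tensorInr_lAutGen_le (X : C) (x y z : F.obj X) :
    tensorInl (lAutGen X x y) ⊓ tensorInr (lAutGen X y z) ≤ lAutMul F (lAutGen X x z) := by
  rw [← sharp_eq_inl_inf_inr]
  exact (le_iSup (fun y => sharp (TensorCov _ _) (lAutGen X x y, lAutGen X y z)) y).trans
    (invImage_mul F X x z).ge

lemma lAutUnit_lAutGen_of_ne {X : C} {x y : F.obj X} (h : x ≠ y) :
    lAutUnit F (lAutGen X x y) = ⊥ :=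
  (congrArg (fun a => a.val X x y) (autOfHom_one F)).trans (if_neg h)

lemma exists_lAutGen_le_of_lAutUnit_ne_bot [IsCofiltered F.Elements] {T : LAutFrame F}
    (hT : lAutUnit F T ≠ ⊥) : ∃ (Z : C) (z : F.obj Z), lAutGen Z z z ≤ T := by
  contrapose! hT
  rw [eq_iSup_lAutGen T]
  simp only [map_iSup, iSup_eq_bot]
  intro p hp
  refine lAutUnit_lAutGen_of_ne fun h => hT p.1 p.2.1 ?_
  rwa [← h] at hp

namespace GSet

variable (S : GSet.{v, u} (lAut F))

/-- The element `μ^*[<x | y>]` of the frame `lAut(F)`: this is `GSet.act` with its value read in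
`LAutFrame F` rather than in the underlying type of an object of `Frm`. -/
noncomputable def rel (x y : S.carrier) : LAutFrame F := S.act x y

lemma rel_univalued {x y z : S.carrier} (h : x ≠ y) : S.rel z x ⊓ S.rel z y = ⊥ :=
  (autOfHom S.action).univalued ⟨⟨⟩⟩ x y z h

lemma rel_injective {x y z : S.carrier} (h : x ≠ y) : S.rel x z ⊓ S.rel y z = ⊥ :=
  (autOfHom S.action).injective ⟨⟨⟩⟩ x y z h

lemma iSup_rel_left (z : S.carrier) : ⨆ x, S.rel x z = ⊤ :=
  (autOfHom S.action).surjective ⟨⟨⟩⟩ z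

lemma lAutUnit_rel_self (x : S.carrier) : lAutUnit F (S.rel x x) = ⊤ := by
  have := S.isMonHom_action
  have h : autOfHom (η[lAut F] ≫ S.action) = 1 := by rw [IsMonHom.one_hom, autOfHom_one]
  exact (congrArg (fun a => a.val ⟨⟨⟩⟩ x x) h).trans (if_pos rfl)

lemma autOfHom_mul_comp_action :
    autOfHom (μ[lAut F] ≫ S.action) =
      autOfHom (fst (lAut F) (lAut F) ≫ S.action) *
        autOfHom (snd (lAut F) (lAut F) ≫ S.action) := by
  have := S.isMonHom_action
  rw [IsMonHom.mul_hom, autOfHom_comp, autOfHom_mul, ValuedAut.map_mul, ← autOfHom_comp,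
    ← autOfHom_comp, tensorHom_fst, tensorHom_snd]

lemma lAutMul_rel (x y : S.carrier) :
    lAutMul F (S.rel x y) = ⨆ z, tensorInl (S.rel x z) ⊓ tensorInr (S.rel z y) :=
  congrArg (fun a => a.val ⟨⟨⟩⟩ x y) S.autOfHom_mul_comp_action

variable {S}

lemma lAutMul_rel_inf_tensorInl_le (x y z : S.carrier) :
    lAutMul F (S.rel x y) ⊓ tensorInl (S.rel x z) ≤ tensorInr (S.rel z y) := by
  rw [lAutMul_rel, iSup_inf_eq]
  refine iSup_le fun z' => ?_
  rcases eq_or_ne z' z with rfl | hz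
  · exact inf_le_left.trans inf_le_right
  · rw [inf_right_comm, ← map_inf, S.rel_univalued hz, map_bot, bot_inf_eq]
    exact bot_le

lemma lAutMul_rel_inf_tensorInr_le (x y z : S.carrier) :
    lAutMul F (S.rel x y) ⊓ tensorInr (S.rel z y) ≤ tensorInl (S.rel x z) := by
  rw [lAutMul_rel, iSup_inf_eq]
  refine iSup_le fun z' => ?_
  rcases eq_or_ne z' z with rfl | hz
  · exact inf_le_left.trans inf_le_left
  · rw [inf_assoc, ← map_inf, S.rel_injective hz, map_bot, inf_bot_eq]
    exact bot_le

lemma eq_of_le_rel {a : LAutFrame F} (ha : a ≠ ⊥) {x y y' : S.carrier} (h : a ≤ S.rel x y)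
    (h' : a ≤ S.rel x y') : y = y' := by
  by_contra hne
  exact ha (bot_unique ((le_inf h h').trans (S.rel_univalued hne).le))

end GSet

section FiberMap

variable {S : GSet.{v, u} (lAut F)} {X Y : C}

/-- The function `FX → S` underlying a morphism of `G`-sets `μF(X) ⟶ S`. -/
def fiberMap (h : (muF F).obj X ⟶ S) : F.obj X → S.carrier := h.toFun

lemma lAutGen_le_rel (h : (muF F).obj X ⟶ S) (x y : F.obj X) :
    lAutGen X x y ≤ S.rel (fiberMap h x) (fiberMap h y) :=
  (invImage_evalAut F X x y).ge.trans (h.act_le x y)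

lemma lAutGen_le_lAutGen (h : (muF F).obj X ⟶ (muF F).obj Y) (x y : F.obj X) :
    lAutGen X x y ≤ lAutGen (F := F) Y (fiberMap h x) (fiberMap h y) :=
  (lAutGen_le_rel h x y).trans (invImage_evalAut F Y _ _).le

lemma exists_fiberMap_eq (k : F.obj X → S.carrier)
    (hk : ∀ x y, lAutGen X x y ≤ S.rel (k x) (k y)) :
    ∃ h : (muF F).obj X ⟶ S, fiberMap h = k :=
  ⟨⟨k, fun x y => (invImage_evalAut F X x y).le.trans (hk x y)⟩, rfl⟩

lemma fiberMap_map_comp (f : Y ⟶ X) (h : (muF F).obj X ⟶ S) (y : F.obj Y) :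
    fiberMap ((muF F).map f ≫ h) y = fiberMap h (F.map f y) := rfl

lemma fiberMap_injective :
    Function.Injective (fiberMap : ((muF F).obj X ⟶ S) → F.obj X → S.carrier) :=
  fun _ _ => GSet.Hom.ext

end FiberMap

variable [IsCofiltered F.Elements]

lemma exists_lAutGen_le_rel (S : GSet.{v, u} (lAut F)) (s : S.carrier) :
    ∃ (Z : C) (z : F.obj Z), lAutGen Z z z ≤ S.rel s s :=
  exists_lAutGen_le_of_lAutUnit_ne_bot (by rw [S.lAutUnit_rel_self]; exact top_ne_bot)

variable [∀ {X Y : C} (f : X ⟶ Y), Epi (F.map f)] {S : GSet.{v, u} (lAut F)}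

lemma exists_rel_of_lAutGen_le {s : S.carrier} {Z : C} {z : F.obj Z}
    (h : lAutGen Z z z ≤ S.rel s s) (z' : F.obj Z) : ∃ t, lAutGen Z z z' ≤ S.rel s t := by
  obtain ⟨t, ht⟩ : ∃ t, lAutGen Z z' z ⊓ S.rel t s ≠ ⊥ := by
    by_contra! ht
    refine lAutGen_ne_bot z' z ?_
    rw [← inf_top_eq (lAutGen Z z' z), ← S.iSup_rel_left s, inf_iSup_eq]
    exact iSup_eq_bot.2 ht
  refine ⟨t, le_of_tensorInl_inf_tensorInr_le_tensorInl ht ?_⟩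
  calc tensorInl (lAutGen Z z z') ⊓ tensorInr (lAutGen Z z' z ⊓ S.rel t s)
      = tensorInl (lAutGen Z z z') ⊓ tensorInr (lAutGen Z z' z) ⊓ tensorInr (S.rel t s) := by
        rw [map_inf, inf_assoc]
    _ ≤ lAutMul F (S.rel s s) ⊓ tensorInr (S.rel t s) :=
        inf_le_inf_right _ ((tensorInl_lAutGen_inf_tensorInr_lAutGen_le Z z z' z).trans
          (OrderHomClass.mono (lAutMul F) h))
    _ ≤ tensorInl (S.rel s t) := GSet.lAutMul_rel_inf_tensorInr_le s s t

lemma exists_hom_of_lAutGen_le_rel {s : S.carrier} {Z : C} {z : F.obj Z}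
    (h : lAutGen Z z z ≤ S.rel s s) : ∃ k : (muF F).obj Z ⟶ S, fiberMap k z = s := by
  choose k hk using exists_rel_of_lAutGen_le h
  have lAutGen_le (x y : F.obj Z) : lAutGen Z x y ≤ S.rel (k x) (k y) := by
    refine le_of_tensorInl_inf_tensorInr_le_tensorInr (lAutGen_ne_bot z x) ?_
    calc tensorInl (lAutGen Z z x) ⊓ tensorInr (lAutGen Z x y)
        ≤ lAutMul F (S.rel s (k y)) ⊓ tensorInl (S.rel s (k x)) :=
          le_inf ((tensorInl_lAutGen_inf_tensorInr_lAutGen_le Z z x y).trans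
            (OrderHomClass.mono (lAutMul F) (hk y)))
            (inf_le_left.trans (OrderHomClass.mono tensorInl (hk x)))
      _ ≤ tensorInr (S.rel (k x) (k y)) := GSet.lAutMul_rel_inf_tensorInl_le s (k y) (k x)
  obtain ⟨k, rfl⟩ := exists_fiberMap_eq k lAutGen_le
  exact ⟨k, GSet.eq_of_le_rel (lAutGen_ne_bot z z) (hk z) h⟩

variable (S) in
lemma exists_fiberMap_apply_eq (s : S.carrier) :
    ∃ (Z : C) (z : F.obj Z) (k : (muF F).obj Z ⟶ S), fiberMap k z = s := by
  obtain ⟨Z, z, h⟩ := exists_lAutGen_le_rel S s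
  exact ⟨Z, z, exists_hom_of_lAutGen_le_rel h⟩

lemma hom_eq_of_fiberMap_eq {X : C} {h k : (muF F).obj X ⟶ S} (x : F.obj X)
    (hx : fiberMap h x = fiberMap k x) : h = k :=
  fiberMap_injective (funext fun y => GSet.eq_of_le_rel (lAutGen_ne_bot x y)
    (hx ▸ lAutGen_le_rel h x y) (lAutGen_le_rel k x y))

variable [∀ X, Nonempty (F.obj X)]

lemma nonemptyTransitive_muF (X : C) : GSet.nonemptyTransitive (lAut F) ((muF F).obj X) :=
  ⟨inferInstanceAs (Nonempty (F.obj X)),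
    fun x y h => lAutGen_ne_bot x y ((invImage_evalAut F X x y).symm.trans h)⟩

variable [∀ {X Y : C} (f : X ⟶ Y), EffectiveEpi f]

instance : (muF F).Full where
  map_surjective {X Y} h := by
    let x : F.obj X := Classical.arbitrary _
    obtain ⟨f, hf, -⟩ := exists_hom_of_lAutGen_le (lAutGen_le_lAutGen h x x)
    exact ⟨f, hom_eq_of_fiberMap_eq x hf⟩

omit [∀ {X Y : C} (f : X ⟶ Y), Epi (F.map f)] in
instance : (muF F).Faithful where
  map_injective {X _ _ _} h :=
    hom_eq_of_map_eq (Classical.arbitrary (F.obj X)) (congrArg (fun k => fiberMap k _) h)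

end Actions

section HomSheaf

variable {C : Type u} [Category.{v₁} C] {F : C ⥤ Type v} {S T : GSet.{v, u} (lAut F)} {X Y : C}

variable (F) in
/-- The functor `S ↦ ℬG(μF(-), S)`. -/
noncomputable def homPresheaf : GSet.{v, u} (lAut F) ⥤ Cᵒᵖ ⥤ Type v :=
  yoneda ⋙ (Functor.whiskeringLeft Cᵒᵖ (GSet.{v, u} (lAut F))ᵒᵖ (Type v)).obj (muF F).op

lemma rel_fiberMap_le_iSup (h : (muF F).obj X ⟶ S) (x : F.obj X) (s : S.carrier) :
    S.rel (fiberMap h x) s ≤ ⨆ (y : F.obj X) (_ : fiberMap h y = s), lAutGen X x y := by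
  rw [← inf_top_eq (S.rel (fiberMap h x) s), ← (genericAut F).total X x, inf_iSup_eq]
  refine iSup_le fun y => ?_
  by_cases hy : fiberMap h y = s
  · exact inf_le_right.trans (le_iSup₂_of_le (f := fun y _ => lAutGen X x y) y hy le_rfl)
  · exact ((inf_le_inf_left _ (lAutGen_le_rel h x y)).trans
      (S.rel_univalued (Ne.symm hy)).le).trans bot_le

variable [∀ {X Y : C} (f : X ⟶ Y), Epi (F.map f)]

instance (f : Y ⟶ X) : Epi ((muF F).map f) where
  left_cancellation h k hhk := fiberMap_injective (funext fun x => by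
    obtain ⟨y, rfl⟩ := map_surjective f x
    exact congrArg (fun k => fiberMap k y) hhk)

variable [IsCofiltered F.Elements]

lemma exists_map_comp_eq (f : Y ⟶ X) (h : (muF F).obj Y ⟶ S)
    (hh : ∀ {V : C} (s t : V ⟶ Y), s ≫ f = t ≫ f → (muF F).map s ≫ h = (muF F).map t ≫ h) :
    ∃ k : (muF F).obj X ⟶ S, (muF F).map f ≫ k = h := by
  have constant_on_fiber {y y' : F.obj Y} (hy : F.map f y = F.map f y') :
      fiberMap h y = fiberMap h y' := by
    obtain ⟨V, v, s, t, hst, rfl, rfl⟩ := exists_map_eq_comp_eq f f hy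
    exact congrArg (fun k => fiberMap k v) (hh s t hst)
  choose σ hσ using map_surjective (F := F) f
  obtain ⟨k, hk⟩ := exists_fiberMap_eq (S := S) (fun x => fiberMap h (σ x)) fun x x' => by
    have := (genericAut F).val_le_iSup_fiber f (σ x) x'
    rw [hσ] at this
    refine this.trans (iSup₂_le fun y' hy' => (lAutGen_le_rel h _ _).trans ?_)
    rw [constant_on_fiber (hy'.trans (hσ x').symm)]
  refine ⟨k, fiberMap_injective (funext fun y => ?_)⟩
  rw [fiberMap_map_comp, hk]
  exact constant_on_fiber (hσ _)

lemma isSheaf_homPresheaf (hro : GrothendieckTopology.RightOreCondition C)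
    (S : GSet.{v, u} (lAut F)) :
    Presheaf.IsSheaf (GrothendieckTopology.atomic hro) ((homPresheaf F).obj S) := by
  rw [isSheaf_iff_isSheaf_of_type, isSheaf_atomic_iff]
  intro X Y f
  rw [Presieve.isSheafFor_singleton]
  intro h hh
  obtain ⟨k, hk⟩ := exists_map_comp_eq f h hh
  exact ⟨k, hk, fun k' hk' => (cancel_epi ((muF F).map f)).1 (hk'.trans hk.symm)⟩

variable (F) in
/-- The functor `S ↦ ℬG(μF(-), S)`, with values in the sheaves for the atomic topology. -/
noncomputable def homSheaf (hro : GrothendieckTopology.RightOreCondition C) :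
    GSet.{v, u} (lAut F) ⥤ Sheaf (GrothendieckTopology.atomic hro) (Type v) :=
  ObjectProperty.lift _ (homPresheaf F) (isSheaf_homPresheaf hro)

instance : (homPresheaf F).Faithful where
  map_injective {S T h k} hhk := GSet.Hom.ext (funext fun s => by
    obtain ⟨Z, z, p, rfl⟩ := exists_fiberMap_apply_eq S s
    have hp : p ≫ h = p ≫ k := ConcreteCategory.congr_hom (NatTrans.congr_app hhk (op Z)) p
    exact congrArg (fun q => fiberMap q z) hp)

/-- The component at `X` of a morphism `φ : ℬG(μF(-), S) ⟶ ℬG(μF(-), T)`, as a function between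
sets of morphisms of `G`-sets. -/
def postcomp (φ : (homPresheaf F).obj S ⟶ (homPresheaf F).obj T) (h : (muF F).obj X ⟶ S) :
    (muF F).obj X ⟶ T :=
  φ.app (op X) h

omit [∀ {X Y : C} (f : X ⟶ Y), Epi (F.map f)] [IsCofiltered F.Elements] in
lemma postcomp_map_comp (φ : (homPresheaf F).obj S ⟶ (homPresheaf F).obj T) (f : Y ⟶ X)
    (h : (muF F).obj X ⟶ S) : postcomp φ ((muF F).map f ≫ h) = (muF F).map f ≫ postcomp φ h :=
  ConcreteCategory.congr_hom (φ.naturality f.op) h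

lemma fiberMap_postcomp_eq (φ : (homPresheaf F).obj S ⟶ (homPresheaf F).obj T)
    {h : (muF F).obj X ⟶ S} {k : (muF F).obj Y ⟶ S} {x : F.obj X} {y : F.obj Y}
    (hxy : fiberMap h x = fiberMap k y) :
    fiberMap (postcomp φ h) x = fiberMap (postcomp φ k) y := by
  obtain ⟨Z, z, f, g, rfl, rfl⟩ := exists_map_eq_map_eq F x y
  have hfg : (muF F).map f ≫ h = (muF F).map g ≫ k := hom_eq_of_fiberMap_eq z hxy
  rw [← fiberMap_map_comp, ← fiberMap_map_comp, ← postcomp_map_comp, ← postcomp_map_comp, hfg]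

instance : (homPresheaf F).Full where
  map_surjective {S T} φ := by
    choose Z z p hp using exists_fiberMap_apply_eq S
    let k (s : S.carrier) : T.carrier := fiberMap (postcomp φ (p s)) (z s)
    have k_fiberMap {X : C} (h : (muF F).obj X ⟶ S) (x : F.obj X) :
        k (fiberMap h x) = fiberMap (postcomp φ h) x :=
      fiberMap_postcomp_eq φ (hp _)
    have rel_le (s s' : S.carrier) : S.rel s s' ≤ T.rel (k s) (k s') := by
      have := rel_fiberMap_le_iSup (p s) (z s) s'
      rw [hp] at this
      refine this.trans (iSup₂_le fun y hy => ?_)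
      rw [← hy, k_fiberMap]
      exact lAutGen_le_rel (postcomp φ (p s)) (z s) y
    refine ⟨⟨k, rel_le⟩, ?_⟩
    ext X h
    exact fiberMap_injective (X := X.unop) (funext fun x => k_fiberMap h x)

end HomSheaf

section Stalk

variable {C : Type u} [Category.{v₁} C] {J : GrothendieckTopology C}
  (Φ : GrothendieckTopology.Point.{v} J) {P : Cᵒᵖ ⥤ Type v}

lemma exists_map_eq_of_toPresheafFiber_eq [LocallySmall.{v} C] {X Y : C} {x : Φ.fiber.obj X}
    {y : Φ.fiber.obj Y} {p : P.obj (op X)} {q : P.obj (op Y)}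
    (h : Φ.toPresheafFiber X x P p = Φ.toPresheafFiber Y y P q) :
    ∃ (Z : C) (z : Φ.fiber.obj Z) (f : Z ⟶ X) (g : Z ⟶ Y), Φ.fiber.map f z = x ∧
      Φ.fiber.map g z = y ∧ P.map f.op p = P.map g.op q := by
  obtain ⟨W, w, f, g, rfl, rfl⟩ := exists_map_eq_map_eq Φ.fiber x y
  rw [← Φ.toPresheafFiber_w_apply, ← Φ.toPresheafFiber_w_apply, Φ.toPresheafFiber_eq_iff'] at h
  obtain ⟨Z, k, z, rfl, hk⟩ := h
  refine ⟨Z, z, k ≫ f, k ≫ g, by simp, by simp, ?_⟩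
  simpa using hk

section StalkVal

variable {H : Type w} [Order.Frame H] (a b : ValuedAut Φ.fiber H)

/-- The value `⟨s | t⟩` of the automorphism of the stalk of a presheaf `P` at a point `Φ` which is
induced by an automorphism of the fiber functor of `Φ`. -/
def stalkVal (s t : Φ.presheafFiber.obj P) : H :=
  ⨆ (X : C) (p : P.obj (op X)) (x : Φ.fiber.obj X) (y : Φ.fiber.obj X)
    (_ : Φ.toPresheafFiber X x P p = s) (_ : Φ.toPresheafFiber X y P p = t), a.val X x y

lemma val_le_stalkVal {X : C} (p : P.obj (op X)) (x y : Φ.fiber.obj X) :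
    a.val X x y ≤ stalkVal Φ a (Φ.toPresheafFiber X x P p) (Φ.toPresheafFiber X y P p) :=
  le_iSup_of_le X <| le_iSup_of_le p <| le_iSup_of_le x <| le_iSup_of_le y <|
    le_iSup_of_le rfl <| le_iSup_of_le rfl le_rfl

variable {Φ a} in
lemma stalkVal_le {s t : Φ.presheafFiber.obj P} {c : H}
    (h : ∀ (X : C) (p : P.obj (op X)) (x y : Φ.fiber.obj X), Φ.toPresheafFiber X x P p = s →
      Φ.toPresheafFiber X y P p = t → a.val X x y ≤ c) : stalkVal Φ a s t ≤ c :=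
  iSup_le fun X => iSup_le fun p => iSup_le fun x => iSup_le fun y => iSup_le fun hx =>
    iSup_le fun hy => h X p x y hx hy

lemma stalkVal_inv (s t : Φ.presheafFiber.obj P) : stalkVal Φ a⁻¹ s t = stalkVal Φ a t s := by
  refine le_antisymm (stalkVal_le fun X p x y hx hy => ?_)
    (stalkVal_le fun X p x y hx hy => ?_) <;> subst hx hy
  · exact val_le_stalkVal Φ a p y x
  · exact val_le_stalkVal Φ a⁻¹ p y x

variable [LocallySmall.{v} C]

lemma iSup_stalkVal (s : Φ.presheafFiber.obj P) : ⨆ t, stalkVal Φ a s t = ⊤ := by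
  obtain ⟨X, x, p, rfl⟩ := Φ.toPresheafFiber_jointly_surjective (P := P) s
  refine top_unique ((a.total X x).ge.trans (iSup_le fun y => ?_))
  exact le_iSup_of_le (Φ.toPresheafFiber X y P p) (val_le_stalkVal Φ a p x y)

lemma stalkVal_toPresheafFiber {X : C} (x : Φ.fiber.obj X) (p : P.obj (op X))
    (t : Φ.presheafFiber.obj P) :
    stalkVal Φ a (Φ.toPresheafFiber X x P p) t =
      ⨆ (y : Φ.fiber.obj X) (_ : Φ.toPresheafFiber X y P p = t), a.val X x y := by
  refine le_antisymm (stalkVal_le fun Y q y y' hy hy' => ?_)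
    (iSup₂_le fun y hy => hy ▸ val_le_stalkVal Φ a p x y)
  obtain ⟨Z, z, g, f, rfl, rfl, hqp⟩ := exists_map_eq_of_toPresheafFiber_eq Φ hy
  refine (a.val_le_iSup_fiber g z y').trans (iSup₂_le fun z' hz' => (a.natural f z z').trans ?_)
  refine le_iSup₂_of_le (f := fun y _ => a.val X (Φ.fiber.map f z) y) (Φ.fiber.map f z') ?_ le_rfl
  rw [← Φ.toPresheafFiber_w_apply, ← hqp, Φ.toPresheafFiber_w_apply, hz', hy']

lemma stalkVal_univalued {s t t' : Φ.presheafFiber.obj P} (h : t ≠ t') :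
    stalkVal Φ a s t ⊓ stalkVal Φ a s t' = ⊥ := by
  obtain ⟨X, x, p, rfl⟩ := Φ.toPresheafFiber_jointly_surjective (P := P) s
  rw [stalkVal_toPresheafFiber, stalkVal_toPresheafFiber, iSup₂_inf_eq]
  refine bot_unique (iSup₂_le fun y hy => ?_)
  rw [inf_iSup₂_eq]
  refine iSup₂_le fun y' hy' => (a.univalued X _ _ _ ?_).le
  rintro rfl
  exact h (hy.symm.trans hy')

variable (P) in
/-- The automorphism of the stalk of `P` at `Φ` induced by an automorphism of the fiber functor. -/
def stalkAut : ValuedAut (Functor.fromPUnit.{u} (Φ.presheafFiber.obj P)) H where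
  val _ s t := stalkVal Φ a s t
  natural _ _ _ := le_rfl
  univalued _ _ _ _ h := stalkVal_univalued Φ a h
  injective _ s s' t h := by
    rw [← stalkVal_inv Φ a t s, ← stalkVal_inv Φ a t s']
    exact stalkVal_univalued Φ a⁻¹ h
  total _ s := iSup_stalkVal Φ a s
  surjective _ s := by
    simp only [← stalkVal_inv Φ a]
    exact iSup_stalkVal Φ a⁻¹ s

lemma stalkAut_one : stalkAut Φ P (1 : ValuedAut Φ.fiber H) = 1 := by
  classical
  ext _ s t
  change stalkVal Φ 1 s t = if s = t then ⊤ else ⊥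
  obtain ⟨X, x, p, rfl⟩ := Φ.toPresheafFiber_jointly_surjective (P := P) s
  rw [stalkVal_toPresheafFiber]
  split_ifs with h
  · exact top_unique (le_iSup₂_of_le x h (by rw [ValuedAut.one_val, if_pos rfl]))
  · refine bot_unique (iSup₂_le fun y hy => ?_)
    rw [ValuedAut.one_val, if_neg]
    rintro rfl
    exact h hy

lemma stalkAut_mul : stalkAut Φ P (a * b) = stalkAut Φ P a * stalkAut Φ P b := by
  ext _ s t
  change stalkVal Φ (a * b) s t = ⨆ r : Φ.presheafFiber.obj P, stalkVal Φ a s r ⊓ stalkVal Φ b r t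
  obtain ⟨X, x, p, rfl⟩ := Φ.toPresheafFiber_jointly_surjective (P := P) s
  refine le_antisymm ?_ (iSup_le fun r => ?_)
  · rw [stalkVal_toPresheafFiber]
    refine iSup₂_le fun y hy => iSup_le fun z => le_iSup_of_le (Φ.toPresheafFiber X z P p) ?_
    exact inf_le_inf (val_le_stalkVal Φ a p x z) (hy ▸ val_le_stalkVal Φ b p z y)
  · rw [stalkVal_toPresheafFiber, iSup₂_inf_eq]
    refine iSup₂_le fun z hz => ?_
    subst hz
    rw [stalkVal_toPresheafFiber, stalkVal_toPresheafFiber, inf_iSup₂_eq]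
    refine iSup₂_le fun y hy => le_iSup₂_of_le (f := fun y _ => (a * b).val X x y) y hy ?_
    exact le_iSup (fun z => a.val X x z ⊓ b.val X z y) z

lemma stalkAut_map {K : Type*} [Order.Frame K] (φ : FrameHom H K) :
    stalkAut Φ P (a.map φ) = (stalkAut Φ P a).map φ := by
  ext _ s t
  change stalkVal Φ (a.map φ) s t = φ (stalkVal Φ a s t)
  simp only [stalkVal, map_iSup]
  rfl

end StalkVal

section StalkGSet

open MonoidalCategory CartesianMonoidalCategory MonObj

variable (P) [LocallySmall.{v} C]

/-- The action of `lAut(F)` on the stalk of `P` at a point with fiber functor `F`. -/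
noncomputable def stalkAction : lAut Φ.fiber ⟶ lAutSet.{v, u} (Φ.presheafFiber.obj P) :=
  ofInvImage (classify (stalkAut Φ P (genericAut Φ.fiber)))

lemma autOfHom_comp_stalkAction {H : LocalicSpace.{max u v}} (f : H ⟶ lAut Φ.fiber) :
    autOfHom (f ≫ stalkAction Φ P) = stalkAut Φ P (autOfHom f) := by
  refine Eq.trans ?_ (stalkAut_map Φ (genericAut Φ.fiber) (invImage f)).symm
  exact ValuedAut.ext (funext fun Y => funext fun s => funext fun t =>
    congrArg (invImage f) (classify_lAutGen (stalkAut Φ P (genericAut Φ.fiber)) Y s t))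

instance : IsMonHom (stalkAction Φ P) where
  one_hom := autOfHom_injective (by
    rw [autOfHom_comp_stalkAction, autOfHom_one, autOfHom_one, stalkAut_one])
  mul_hom := autOfHom_injective (by
    rw [autOfHom_comp_stalkAction, autOfHom_mul, autOfHom_comp, autOfHom_mul, ValuedAut.map_mul,
      ← autOfHom_comp, ← autOfHom_comp, tensorHom_fst, tensorHom_snd, autOfHom_comp_stalkAction,
      autOfHom_comp_stalkAction, stalkAut_mul])

/-- The stalk of `P` at a point with fiber functor `F`, as an `lAut(F)`-set. -/
noncomputable def stalkGSet : GSet.{v, u} (lAut Φ.fiber) where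
  carrier := Φ.presheafFiber.obj P
  action := stalkAction Φ P

variable {P}

lemma rel_stalkGSet (s t : Φ.presheafFiber.obj P) :
    (stalkGSet Φ P).rel s t = stalkVal Φ (genericAut Φ.fiber) s t :=
  classify_lAutGen (stalkAut Φ P (genericAut Φ.fiber)) ⟨⟨⟩⟩ s t

lemma exists_fiberMap_eq_toPresheafFiber {X : C} (p : P.obj (op X)) :
    ∃ h : (muF Φ.fiber).obj X ⟶ stalkGSet Φ P,
      fiberMap h = fun x => Φ.toPresheafFiber X x P p :=
  exists_fiberMap_eq (S := stalkGSet Φ P) _ fun x y =>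
    (val_le_stalkVal Φ (genericAut Φ.fiber) p x y).trans (rel_stalkGSet Φ _ _).ge

/-- The morphism of `lAut(F)`-sets `x ↦ p_x` from `FX` to the stalk of `P`, for a section `p` of `P`
over `X`. -/
noncomputable def germHom {X : C} (p : P.obj (op X)) : (muF Φ.fiber).obj X ⟶ stalkGSet Φ P :=
  (exists_fiberMap_eq_toPresheafFiber Φ p).choose

lemma fiberMap_germHom {X : C} (p : P.obj (op X)) (x : Φ.fiber.obj X) :
    fiberMap (germHom Φ p) x = Φ.toPresheafFiber X x P p :=
  congrFun (exists_fiberMap_eq_toPresheafFiber Φ p).choose_spec x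

lemma map_comp_germHom {X Y : C} (f : Y ⟶ X) (p : P.obj (op X)) :
    (muF Φ.fiber).map f ≫ germHom Φ p = germHom Φ (P.map f.op p) :=
  fiberMap_injective (funext fun y => by
    rw [fiberMap_map_comp, fiberMap_germHom, fiberMap_germHom, Φ.toPresheafFiber_w_apply])

variable [∀ X, Nonempty (Φ.fiber.obj X)]

lemma germHom_injective (hP : ∀ ⦃X Y : C⦄ (f : Y ⟶ X), (Presieve.singleton f).IsSeparatedFor P)
    (X : C) : Function.Injective
      (germHom Φ : P.obj (op X) → ((muF Φ.fiber).obj X ⟶ stalkGSet Φ P)) := by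
  intro p q h
  let x : Φ.fiber.obj X := Classical.arbitrary _
  have hx : Φ.toPresheafFiber X x P p = Φ.toPresheafFiber X x P q := by
    rw [← fiberMap_germHom, ← fiberMap_germHom, h]
  obtain ⟨Y, f, y, -, hf⟩ := (Φ.toPresheafFiber_eq_iff' (P := P) X x p q).1 hx
  exact Presieve.isSeparatedFor_singleton.1 (hP f) hf

variable [∀ {X Y : C} (f : X ⟶ Y), Epi (Φ.fiber.map f)]
  (hP : ∀ ⦃X Y : C⦄ (f : Y ⟶ X), (Presieve.singleton f).IsSheafFor P)

include hP

lemma germHom_surjective (X : C) : Function.Surjective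
    (germHom Φ : P.obj (op X) → ((muF Φ.fiber).obj X ⟶ stalkGSet Φ P)) := by
  intro h
  let x : Φ.fiber.obj X := Classical.arbitrary _
  obtain ⟨Y, y, q, hq⟩ := Φ.toPresheafFiber_jointly_surjective (P := P) (fiberMap h x)
  obtain ⟨Z, z, f, g, hx, rfl⟩ := exists_map_eq_map_eq Φ.fiber x y
  have map_comp_eq : (muF Φ.fiber).map f ≫ h = germHom Φ (P.map g.op q) :=
    hom_eq_of_fiberMap_eq z (by
      rw [fiberMap_germHom, fiberMap_map_comp, Φ.toPresheafFiber_w_apply, hx]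
      exact hq.symm)
  obtain ⟨p, hp, -⟩ := Presieve.isSheafFor_singleton.1 (hP f) (P.map g.op q) fun s t hst =>
    germHom_injective Φ (fun _ _ f => (hP f).isSeparatedFor) _ (by
      rw [← map_comp_germHom Φ s, ← map_comp_germHom Φ t, ← map_comp_eq, ← Category.assoc,
        ← Category.assoc, ← Functor.map_comp, ← Functor.map_comp, hst])
  refine ⟨p, (cancel_epi ((muF Φ.fiber).map f)).1 ?_⟩
  rw [map_comp_germHom, hp, map_comp_eq]

/-- A sheaf is recovered from its stalk as the sheaf of morphisms of `lAut(F)`-sets to the stalk. -/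
noncomputable def germIso : P ≅ (homPresheaf Φ.fiber).obj (stalkGSet Φ P) :=
  NatIso.ofComponents
    (fun X => (Equiv.ofBijective (germHom Φ)
      ⟨germHom_injective Φ (fun _ _ f => (hP f).isSeparatedFor) X.unop,
        germHom_surjective Φ hP X.unop⟩).toIso)
    (fun f => by
      ext p
      exact (map_comp_germHom Φ f.unop p).symm)

end StalkGSet

end Stalk

section Equivalence

variable {C : Type u} [Category.{v₁} C] (F : C ⥤ Type v) [IsCofiltered F.Elements]
  [∀ {X Y : C} (f : X ⟶ Y), Epi (F.map f)] (hro : GrothendieckTopology.RightOreCondition C)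

/-- A functor `F` with cofiltered category of elements which sends all morphisms to surjections, as
a point of the atomic site. -/
abbrev atomicPoint [InitiallySmall.{v} F.Elements] :
    GrothendieckTopology.Point.{v} (GrothendieckTopology.atomic hro) where
  fiber := F
  jointly_surjective R hR x := by
    obtain ⟨Y, f, hf⟩ := hR
    obtain ⟨y, hy⟩ := map_surjective f x
    exact ⟨Y, f, hf, y, hy⟩

variable [∀ X, Nonempty (F.obj X)] [InitiallySmall.{v} F.Elements]

instance [LocallySmall.{v} C] : (homSheaf F hro).IsEquivalence where
  faithful := inferInstanceAs (ObjectProperty.lift _ _ _).Faithful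
  full := inferInstanceAs (ObjectProperty.lift _ _ _).Full
  essSurj.mem_essImage P := by
    have hP := (isSheaf_atomic_iff hro P.obj).1 ((isSheaf_iff_isSheaf_of_type _ _).1 P.property)
    exact ⟨stalkGSet (atomicPoint F hro) P.obj, ⟨((fullyFaithfulSheafToPresheaf _ _).preimageIso
      (X := P) (Y := (homSheaf F hro).obj _) (germIso (atomicPoint F hro) hP)).symm⟩⟩

end Equivalence

section InducesEquivalence

variable {C : Type u} [Category.{v} C] {F : C ⥤ Type v} [IsCofiltered F.Elements]
  [∀ {X Y : C} (f : X ⟶ Y), Epi (F.map f)] [∀ X, Nonempty (F.obj X)]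

variable (F) in
/-- A morphism `X ⟶ Y` is the same as a morphism of `lAut(F)`-sets `μF(X) ⟶ μF(Y)`. -/
noncomputable def muFCompHomPresheafIso [∀ {X Y : C} (f : X ⟶ Y), EffectiveEpi f] :
    muF F ⋙ homPresheaf F ≅ yoneda :=
  (NatIso.ofComponents (fun X => NatIso.ofComponents
    (fun Y => ((Functor.FullyFaithful.ofFullyFaithful (muF F)).homEquiv
      (X := Y.unop) (Y := X)).toIso)
    (fun g => by ext f; exact (muF F).map_comp g.unop f))
    (fun g => by ext Y f; exact (muF F).map_comp f g)).symm

lemma inducesEquivalence_muF [InitiallySmall.{v} F.Elements]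
    [∀ {X Y : C} (f : X ⟶ Y), EffectiveEpi f]
    (hro : GrothendieckTopology.RightOreCondition C) :
    InducesEquivalence (GrothendieckTopology.atomic hro) (muF F) :=
  ⟨(homSheaf F hro).asEquivalence.symm, ⟨Iso.refl _⟩, ⟨muFCompHomPresheafIso F⟩⟩

end InducesEquivalence

end LocalicGalois

theorem mainTheorem2_general {C : Type u} [Category.{v} C] (F : C ⥤ Type v)
    (hF : IsProrepresentable F)
    (hC : ∀ {Y X : C} (f : Y ⟶ X), EffectiveEpi f)
    (hne : ∀ X : C, Nonempty (F.obj X))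
    (hepi : F.PreservesEffectiveEpis) :
    (∀ X : C, GSet.nonemptyTransitive (lAut F) ((muF F).obj X)) ∧
    Small.{v} (lAut F).unop ∧
    (¬ Nonempty (C ≌ Discrete PUnit.{1}) →
      InducesEquivalence (Sheaf.canonicalTopology C) (muF F)) ∧
    ∃ hro : GrothendieckTopology.RightOreCondition C,
      InducesEquivalence (GrothendieckTopology.atomic hro) (muF F) := by
  obtain ⟨_, _⟩ := hF.isCofiltered_and_initiallySmall
  have {X Y : C} (f : X ⟶ Y) : Epi (F.map f) := inferInstance
  have hro : GrothendieckTopology.RightOreCondition C := rightOreCondition F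
  refine ⟨nonemptyTransitive_muF, small_lAutFrame, fun hpt => ?_, hro, inducesEquivalence_muF hro⟩
  rw [← atomic_eq_canonicalTopology hro hpt]
  exact inducesEquivalence_muF hro

theorem mainTheorem2 {C : Type u} [Category.{v} C] (F : C ⥤ Type v)
    (hF : IsProrepresentable F)
    (hC : ∀ {Y X : C} (f : Y ⟶ X), EffectiveEpi f)
    (hne : ∀ X : C, Nonempty (F.obj X))
    (hepi : F.PreservesEffectiveEpis) :
    (∀ X : C, GSet.nonemptyTransitive (lAut F) ((muF F).obj X)) ∧
    (Small.{v} C →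
      Small.{v} (lAut F).unop ∧
      (¬ Nonempty (C ≌ Discrete PUnit.{1}) →
        InducesEquivalence (Sheaf.canonicalTopology C) (muF F)) ∧
      ∃ hro : GrothendieckTopology.RightOreCondition C,
        InducesEquivalence (GrothendieckTopology.atomic hro) (muF F)) := by
  obtain ⟨htrans, h⟩ := mainTheorem2_general F hF hC hne hepi
  exact ⟨htrans, fun _ => h⟩
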